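/- Let $\mathcal T$ be a $K$-linear triangulated category over a field $K$, of finite type: $\bigoplus_{i\in\mathbb Z}\mathrm{Hom}(E,F[i])$ is finite-dimensional for all objects $E,F$. Write $\hom^i(E,F)=\dim_K\mathrm{Hom}(E,F[i])$, $\hom=\hom^0$, and $\chi(E,F)=\sum_i(-1)^i\hom^i(E,F)$. Suppose that $\mathcal T$ has a Serre functor $S$, i.e. a $K$-linear autoequivalence with isomorphisms $\mathrm{Hom}(E,F)\cong\mathrm{Hom}(F,S(E))^*$ natural in $E$ and $F$. Let $\mathcal N(\mathcal T)=K(\mathcal T)/\ker\chi$ be the numerical Grothendieck group, with the form induced by $\chi$. Assume: (C1) $S^r\cong[k]$ for some integers $r\ge 1$ and $k$ such that either $0<k/r<2$, or $r=2$ and $k=4$. (C2) $\mathcal N(\mathcal T)$ has rank $2$, and $\ell:=\max\{\chi(v,v): 0\ne v\in\mathcal N(\mathcal T)\}<0$. (C3) There is an object $Q$ of $\mathcal T$ with $$-\ell+1\le\hom^1(Q,Q)<-2\ell+2.\qquad(*)$$ If $r=2$ and $k=4$, there are two objects $Q_1,Q_2$ satisfying $(*)$ such that $Q_1$ is isomorphic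 neither to $Q_2$ nor to $Q_2[1]$, $\hom(Q_2,Q_1)\ne0$ and $\hom(Q_1,Q_2[1])\ne0$. A numerical stability condition on $\mathcal T$ is a pair $\sigma=(\mathcal P,Z)$ of a slicing $\mathcal P=(\mathcal P(\phi))_{\phi\in\mathbb R}$ of $\mathcal T$ and a homomorphism $Z:\mathcal N(\mathcal T)\to\mathbb C$ with $Z(E)\in\mathbb R_{>0}e^{i\pi\phi}$ for $0\ne E\in\mathcal P(\phi)$, satisfying the support property: there is a quadratic form on $\mathcal N(\mathcal T)\otimes\mathbb R$ that is negative definite on $\ker Z$ and nonnegative on the classes of all objects of all $\mathcal P(\phi)$. The elements of the universal cover $\widetilde{\mathrm{GL}}{}_2^+(\mathbb R)$ are the pairs $\tilde g=(g,M)$ with $g:\mathbb R\to\mathbb R$ increasing, $g(\phi+1)=g(\phi)+1$, $M\in\mathrm{GL}_2^+(\mathbb R)$ acting on $\mathbb C=\mathbb R^2$, and $Me^{i\pi\phi}\in\mathbb R_{>0}e^{i\pi g(\phi)}$ for all $\phi$. They act by $\sigma\cdot\tilde g=(\mathcal P',M^{-1}\circ Z)$ with $\mathcal P'(\phi)=\mathcal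 P(g(\phi))$. The stability condition $\sigma$ is Serre-invariant if $S\cdot\sigma=\sigma\cdot\tilde g$ for some $\tilde g\in\widetilde{\mathrm{GL}}{}_2^+(\mathbb R)$, where $S\cdot(\mathcal P,Z)=(S(\mathcal P),Z\circ S_*^{-1})$. Then for any two Serre-invariant numerical stability conditions $\sigma_1,\sigma_2$ on $\mathcal T$ there is $\tilde g\in\widetilde{\mathrm{GL}}{}_2^+(\mathbb R)$ with $\sigma_1=\sigma_2\cdot\tilde g$. -/

import Mathlib

open CategoryTheory CategoryTheory.Limits CategoryTheory.Pretriangulated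
open scoped TensorProduct

noncomputable section

universe w v u

namespace StabCond

/-! ### Categories of finite type and the Euler pairing -/

section Euler

variable (K : Type w) [Field K] (C : Type u) [Category.{v} C] [Preadditive C] [Linear K C]
  [HasShift C ℤ]

/-- `C` is of finite type over `K`: for all objects `E`, `F` the space `⊕ᵢ Hom(E, F[i])` is
finite-dimensional, i.e. each summand is finite-dimensional and only finitely many are nonzero. -/
class IsOfFiniteType : Prop where
  finite_hom : ∀ E F : C, Module.Finite K (E ⟶ F)
  finite_support : ∀ E F : C, {i : ℤ | Nontrivial (E ⟶ F⟦i⟧)}.Finite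

variable {C}

/-- `homDim K E F i` is `homⁱ(E, F) = dim_K Hom(E, F[i])`. -/
def homDim (E F : C) (i : ℤ) : ℕ := Module.finrank K (E ⟶ F⟦i⟧)

/-- The Euler characteristic `χ(E, F) = ∑ᵢ (-1)ⁱ homⁱ(E, F)` of a pair of objects. -/
def eulerObj (E F : C) : ℤ := ∑ᶠ i : ℤ, (i.negOnePow : ℤ) * (homDim K E F i : ℤ)

variable {K}

lemma homDim_support_finite [IsOfFiniteType K C] (E F : C) :
    {i : ℤ | homDim K E F i ≠ 0}.Finite := by
  refine (IsOfFiniteType.finite_support (K := K) E F).subset fun i hi => ?_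
  by_contra h
  have : Subsingleton (E ⟶ F⟦i⟧) := not_nontrivial_iff_subsingleton.mp h
  exact hi (Module.finrank_zero_of_subsingleton)

/-- Alternating sums of dimensions along a bounded long exact sequence, in terms of the dimensions
`c i` of the kernels of the maps out of the `x i`. -/
lemma alternating_sum_eq (x y z c : ℤ → ℕ) (hx : {i | x i ≠ 0}.Finite)
    (hz : {i | z i ≠ 0}.Finite) (h : ∀ i, y i + c i + c (i + 1) = x i + z i)
    (hc : ∀ i, c i ≤ x i) :
    ∑ᶠ i : ℤ, (i.negOnePow : ℤ) * (y i : ℤ) =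
      ∑ᶠ i : ℤ, (i.negOnePow : ℤ) * (x i : ℤ) + ∑ᶠ i : ℤ, (i.negOnePow : ℤ) * (z i : ℤ) := by
  have hfin : ∀ t : ℤ → ℕ, {i | t i ≠ 0}.Finite →
      (Function.support fun i : ℤ => (i.negOnePow : ℤ) * (t i : ℤ)).Finite := by
    intro t ht
    refine ht.subset fun i hi => ?_
    simp only [Function.mem_support, ne_eq, mul_eq_zero, not_or] at hi
    exact fun h0 => hi.2 (by simp [h0])
  have hcf : {i | c i ≠ 0}.Finite := hx.subset fun i hi => by
    have := hc i
    simp only [Set.mem_ofPred_eq] at hi ⊢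
    omega
  have hyf : {i | y i ≠ 0}.Finite := (hx.union hz).subset fun i hi => by
    have := h i
    simp only [Set.mem_ofPred_eq, Set.mem_union] at hi ⊢
    omega
  have hcf' : {i | c (i + 1) ≠ 0}.Finite :=
    hcf.preimage ((add_left_injective (1 : ℤ)).injOn)
  have hshift : ∑ᶠ i : ℤ, (i.negOnePow : ℤ) * (c (i + 1) : ℤ) =
      - ∑ᶠ i : ℤ, (i.negOnePow : ℤ) * (c i : ℤ) := by
    rw [← finsum_comp_equiv (Equiv.addRight (1 : ℤ)) (f := fun i : ℤ =>
      (i.negOnePow : ℤ) * (c i : ℤ)), ← finsum_neg_distrib]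
    refine finsum_congr fun i => ?_
    simp [Int.negOnePow_succ]
  have h1 : ∑ᶠ i : ℤ, ((i.negOnePow : ℤ) * (y i : ℤ) + (i.negOnePow : ℤ) * (c i : ℤ)
        + (i.negOnePow : ℤ) * (c (i + 1) : ℤ)) =
      ∑ᶠ i : ℤ, ((i.negOnePow : ℤ) * (x i : ℤ) + (i.negOnePow : ℤ) * (z i : ℤ)) := by
    refine finsum_congr fun i => ?_
    have := h i
    rw [← mul_add, ← mul_add, ← mul_add]
    congr 1
    exact_mod_cast this
  rw [finsum_add_distrib (hfin _ hx) (hfin _ hz), finsum_add_distrib _ (hfin _ hcf'),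
    finsum_add_distrib (hfin _ hyf) (hfin _ hcf), hshift] at h1
  · linarith
  · refine ((hfin _ hyf).union (hfin _ hcf)).subset ?_
    exact Function.support_add _ _

lemma finrank_ker_congr {V W V' W' : Type v} [AddCommGroup V] [AddCommGroup W] [AddCommGroup V']
    [AddCommGroup W'] [Module K V] [Module K W] [Module K V'] [Module K W']
    (f : V →ₗ[K] W) (f' : V' →ₗ[K] W') (e : V ≃ₗ[K] V') (e' : W ≃ₗ[K] W')
    (h : ∀ x, e' (f x) = f' (e x)) :
    Module.finrank K (LinearMap.ker f) = Module.finrank K (LinearMap.ker f') := by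
  refine LinearEquiv.finrank_eq (e.ofSubmodules _ _ ?_)
  ext y
  simp only [Submodule.mem_map, LinearMap.mem_ker]
  constructor
  · rintro ⟨x, hx, rfl⟩
    rw [LinearEquiv.coe_coe, ← h, hx, map_zero]
  · intro hy
    refine ⟨e.symm y, e'.injective ?_, by simp⟩
    rw [h, e.apply_symm_apply, hy, map_zero]

/-- A shift of a linear category induces linear isomorphisms on morphism spaces. -/
def shiftHomEquiv [∀ n : ℤ, (shiftFunctor C n).Additive]
    [∀ n : ℤ, (shiftFunctor C n).Linear K] (n : ℤ) (X Y : C) :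
    (X ⟶ Y) ≃ₗ[K] (X⟦n⟧ ⟶ Y⟦n⟧) :=
  LinearEquiv.ofBijective ((shiftFunctor C n).mapLinearMap K)
    ⟨(shiftFunctor C n).map_injective, (shiftFunctor C n).map_surjective⟩

@[simp] lemma shiftHomEquiv_apply [∀ n : ℤ, (shiftFunctor C n).Additive]
    [∀ n : ℤ, (shiftFunctor C n).Linear K] (n : ℤ) {X Y : C} (f : X ⟶ Y) :
    shiftHomEquiv (K := K) n X Y f = f⟦n⟧' := rfl

lemma homDim_eq_left [∀ n : ℤ, (shiftFunctor C n).Additive]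
    [∀ n : ℤ, (shiftFunctor C n).Linear K] (E F : C) (i : ℤ) :
    homDim K E F i = Module.finrank K (E⟦-i⟧ ⟶ F) :=
  LinearEquiv.finrank_eq ((shiftHomEquiv (K := K) (-i) E (F⟦i⟧)).trans
    (Linear.homCongr K (Iso.refl _) (shiftShiftNeg F i)))

variable [HasZeroObject C] [∀ n : ℤ, (shiftFunctor C n).Additive] [Pretriangulated C]

/-- Dimension count for the exact sequence `Hom(A, X) → Hom(A, Y) → Hom(A, Z) → Hom(A, X[1])`. -/
lemma finrank_coyoneda [IsOfFiniteType K C] (T : Triangle C) (hT : T ∈ distTriang C) (A : C) :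
    Module.finrank K (A ⟶ T.obj₂)
      + Module.finrank K (LinearMap.ker (Linear.rightComp K A T.mor₁))
      + Module.finrank K (LinearMap.ker (Linear.rightComp K A (T.mor₁⟦(1 : ℤ)⟧'))) =
    Module.finrank K (A ⟶ T.obj₁) + Module.finrank K (A ⟶ T.obj₃) := by
  have := fun E F : C => IsOfFiniteType.finite_hom (K := K) E F
  have r1 := (Linear.rightComp K A T.mor₁).finrank_range_add_finrank_ker
  have r2 := (Linear.rightComp K A T.mor₂).finrank_range_add_finrank_ker
  have r3 := (Linear.rightComp K A T.mor₃).finrank_range_add_finrank_ker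
  have e2 : LinearMap.ker (Linear.rightComp K A T.mor₂) =
      LinearMap.range (Linear.rightComp K A T.mor₁) := by
    ext f
    constructor
    · intro hf
      obtain ⟨g, hg⟩ := T.coyoneda_exact₂ hT f hf
      exact ⟨g, hg.symm⟩
    · rintro ⟨g, rfl⟩
      simp [comp_distTriang_mor_zero₁₂ T hT]
  have e3 : LinearMap.ker (Linear.rightComp K A T.mor₃) =
      LinearMap.range (Linear.rightComp K A T.mor₂) := by
    ext f
    constructor
    · intro hf
      obtain ⟨g, hg⟩ := T.coyoneda_exact₃ hT f hf
      exact ⟨g, hg.symm⟩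
    · rintro ⟨g, rfl⟩
      simp [comp_distTriang_mor_zero₂₃ T hT]
  have e1 : LinearMap.ker (Linear.rightComp K A (T.mor₁⟦(1 : ℤ)⟧')) =
      LinearMap.range (Linear.rightComp K A T.mor₃) := by
    ext f
    constructor
    · intro hf
      obtain ⟨g, hg⟩ := T.coyoneda_exact₁ hT f hf
      exact ⟨g, hg.symm⟩
    · rintro ⟨g, rfl⟩
      simp [comp_distTriang_mor_zero₃₁ T hT]
  rw [e2] at r2
  rw [e3] at r3
  rw [e1]
  omega

/-- Dimension count for the exact sequence `Hom(Z, B) → Hom(Y, B) → Hom(X, B) → Hom(Z, B[1])`. -/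
lemma finrank_yoneda [∀ n : ℤ, (shiftFunctor C n).Linear K] [IsOfFiniteType K C]
    (T : Triangle C) (hT : T ∈ distTriang C) (B : C) :
    Module.finrank K (T.obj₂ ⟶ B)
      + Module.finrank K (LinearMap.ker (Linear.leftComp K B T.mor₂))
      + Module.finrank K (LinearMap.ker (Linear.leftComp K (B⟦(1 : ℤ)⟧) T.mor₂)) =
    Module.finrank K (T.obj₃ ⟶ B) + Module.finrank K (T.obj₁ ⟶ B) := by
  have := fun E F : C => IsOfFiniteType.finite_hom (K := K) E F
  have r1 := (Linear.leftComp K B T.mor₁).finrank_range_add_finrank_ker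
  have r2 := (Linear.leftComp K B T.mor₂).finrank_range_add_finrank_ker
  have r3 := (Linear.leftComp K (B⟦(1 : ℤ)⟧) T.mor₃).finrank_range_add_finrank_ker
  have r4 := (Linear.leftComp K (B⟦(1 : ℤ)⟧)
    (T.mor₁⟦(1 : ℤ)⟧')).finrank_range_add_finrank_ker
  have e1 : LinearMap.ker (Linear.leftComp K B T.mor₁) =
      LinearMap.range (Linear.leftComp K B T.mor₂) := by
    ext f
    constructor
    · intro hf
      obtain ⟨g, hg⟩ := T.yoneda_exact₂ hT f hf
      exact ⟨g, hg.symm⟩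
    · rintro ⟨g, rfl⟩
      simp [comp_distTriang_mor_zero₁₂_assoc T hT]
  have e2 : LinearMap.ker (Linear.leftComp K (B⟦(1 : ℤ)⟧) T.mor₂) =
      LinearMap.range (Linear.leftComp K (B⟦(1 : ℤ)⟧) T.mor₃) := by
    ext f
    constructor
    · intro hf
      obtain ⟨g, hg⟩ := T.yoneda_exact₃ hT f hf
      exact ⟨g, hg.symm⟩
    · rintro ⟨g, rfl⟩
      simp [comp_distTriang_mor_zero₂₃_assoc T hT]
  have e3 : LinearMap.ker (Linear.leftComp K (B⟦(1 : ℤ)⟧) T.mor₃) =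
      LinearMap.range (Linear.leftComp K (B⟦(1 : ℤ)⟧) (T.mor₁⟦(1 : ℤ)⟧')) := by
    ext f
    constructor
    · intro hf
      obtain ⟨g, hg⟩ : ∃ g : T.obj₂⟦(1 : ℤ)⟧ ⟶ B⟦(1 : ℤ)⟧, f = (-T.mor₁⟦(1 : ℤ)⟧') ≫ g :=
        T.rotate.yoneda_exact₃ (rot_of_distTriang T hT) f hf
      exact ⟨-g, by simp [hg]⟩
    · rintro ⟨g, rfl⟩
      simp [comp_distTriang_mor_zero₃₁_assoc T hT]
  have k1 : Module.finrank K (LinearMap.ker (Linear.leftComp K B T.mor₁)) =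
      Module.finrank K (LinearMap.ker
        (Linear.leftComp K (B⟦(1 : ℤ)⟧) (T.mor₁⟦(1 : ℤ)⟧'))) :=
    finrank_ker_congr _ _ (shiftHomEquiv 1 _ _) (shiftHomEquiv 1 _ _) fun x => by
      simp
  have d1 := (shiftHomEquiv (K := K) 1 T.obj₁ B).finrank_eq
  have d2 := (shiftHomEquiv (K := K) 1 T.obj₂ B).finrank_eq
  rw [e3] at r3
  rw [e2]
  rw [e1] at r1 k1
  omega

variable [∀ n : ℤ, (shiftFunctor C n).Linear K] [IsOfFiniteType K C]

lemma eulerObj_add_right (E : C) (T : Triangle C) (hT : T ∈ distTriang C) :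
    eulerObj K E T.obj₂ = eulerObj K E T.obj₁ + eulerObj K E T.obj₃ := by
  have := fun E F : C => IsOfFiniteType.finite_hom (K := K) E F
  refine alternating_sum_eq _ _ _
    (fun i => Module.finrank K (LinearMap.ker (Linear.rightComp K (E⟦-i⟧) T.mor₁)))
    (homDim_support_finite _ _) (homDim_support_finite _ _) (fun i => ?_) (fun i => ?_)
  · simp only [homDim_eq_left]
    rw [← finrank_coyoneda T hT]
    congr 1
    let e : (E⟦-(i + 1)⟧)⟦(1 : ℤ)⟧ ≅ E⟦-i⟧ :=
      ((shiftFunctorAdd' C (-(i + 1)) 1 (-i) (by ring)).app E).symm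
    exact finrank_ker_congr _ _
      ((shiftHomEquiv 1 _ _).trans (Linear.homCongr K e (Iso.refl _)))
      ((shiftHomEquiv 1 _ _).trans (Linear.homCongr K e (Iso.refl _))) fun x => by
        simp [Linear.homCongr_apply]
  · simp only [homDim_eq_left]
    exact Submodule.finrank_le _

lemma eulerObj_add_left (F : C) (T : Triangle C) (hT : T ∈ distTriang C) :
    eulerObj K T.obj₂ F = eulerObj K T.obj₁ F + eulerObj K T.obj₃ F := by
  have := fun E F : C => IsOfFiniteType.finite_hom (K := K) E F
  rw [add_comm]
  refine alternating_sum_eq _ _ _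
    (fun i => Module.finrank K (LinearMap.ker (Linear.leftComp K (F⟦i⟧) T.mor₂)))
    (homDim_support_finite _ _) (homDim_support_finite _ _) (fun i => ?_) (fun i => ?_)
  · simp only [homDim]
    rw [← finrank_yoneda T hT]
    congr 1
    let e : F⟦i + 1⟧ ≅ (F⟦i⟧)⟦(1 : ℤ)⟧ := (shiftFunctorAdd C i 1).app F
    exact finrank_ker_congr _ _ (Linear.homCongr K (Iso.refl _) e)
      (Linear.homCongr K (Iso.refl _) e) fun x => by
        simp [Linear.homCongr_apply]
  · exact Submodule.finrank_le _

end Euler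

/-! ### The Grothendieck group and the numerical Grothendieck group -/

section Grothendieck

variable (K : Type w) [Field K] (C : Type u) [Category.{v} C] [Preadditive C] [HasZeroObject C]
  [HasShift C ℤ] [∀ n : ℤ, (shiftFunctor C n).Additive] [Pretriangulated C]

/-- The relations `[Y] = [X] + [Z]` for all distinguished triangles `X ⟶ Y ⟶ Z ⟶ X⟦1⟧`. -/
def k0Relations : AddSubgroup (FreeAbelianGroup C) :=
  AddSubgroup.closure {x | ∃ T ∈ distTriang C, x = FreeAbelianGroup.of T.obj₂ -
    FreeAbelianGroup.of T.obj₁ - FreeAbelianGroup.of T.obj₃}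

/-- The Grothendieck group `K(C)` of the triangulated category `C`. -/
abbrev K0 : Type u := FreeAbelianGroup C ⧸ k0Relations C

variable {C}

/-- The class of an object in the Grothendieck group. -/
def K0.of (E : C) : K0 C := QuotientAddGroup.mk (FreeAbelianGroup.of E)

/-- A function on objects that is additive on distinguished triangles descends to `K(C)`. -/
def K0.lift {A : Type*} [AddCommGroup A] (f : C → A)
    (hf : ∀ T ∈ distTriang C, f T.obj₂ = f T.obj₁ + f T.obj₃) : K0 C →+ A :=
  QuotientAddGroup.lift (k0Relations C) (FreeAbelianGroup.lift f) <| by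
    rw [k0Relations, AddSubgroup.closure_le]
    rintro _ ⟨T, hT, rfl⟩
    simp [hf T hT]

@[simp] lemma K0.lift_of {A : Type*} [AddCommGroup A] (f : C → A)
    (hf : ∀ T ∈ distTriang C, f T.obj₂ = f T.obj₁ + f T.obj₃) (E : C) :
    K0.lift f hf (K0.of E) = f E := by
  simp [K0.lift, K0.of]

lemma K0.hom_ext {A : Type*} [AddCommGroup A] {f g : K0 C →+ A}
    (h : ∀ E : C, f (K0.of E) = g (K0.of E)) : f = g := by
  refine QuotientAddGroup.addMonoidHom_ext _ (FreeAbelianGroup.lift_ext _ _ fun E => h E)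

variable [Linear K C] [∀ n : ℤ, (shiftFunctor C n).Linear K] [IsOfFiniteType K C]

variable (C) in
/-- The Euler form `χ` on the Grothendieck group, the biadditive extension of
`χ(E, F) = ∑ᵢ (-1)ⁱ homⁱ(E, F)`. -/
def eulerForm : K0 C →+ K0 C →+ ℤ :=
  K0.lift (fun E => K0.lift (fun F => eulerObj K E F) fun T hT => eulerObj_add_right E T hT)
    fun T hT => K0.hom_ext fun F => by simp [eulerObj_add_left F T hT]

@[simp] lemma eulerForm_of (E F : C) : eulerForm K C (K0.of E) (K0.of F) = eulerObj K E F := by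
  simp [eulerForm]

variable (C) in
/-- The kernel of the Euler form. The vanishing is asked on both sides; when `C` has a Serre
functor `S`, the left and the right kernel agree because `χ(E, F) = χ(F, S E)`. -/
def eulerKernel : AddSubgroup (K0 C) where
  carrier := {x | ∀ y, eulerForm K C x y = 0 ∧ eulerForm K C y x = 0}
  zero_mem' := fun y => by simp
  add_mem' := fun {a b} ha hb y => by simp [(ha y).1, (ha y).2, (hb y).1, (hb y).2]
  neg_mem' := fun {a} ha y => by simp [(ha y).1, (ha y).2]

variable (C) in
/-- The numerical Grothendieck group `N(C) = K(C) / ker χ`. -/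
abbrev NumK0 : Type u := K0 C ⧸ eulerKernel K C

/-- The class of an object in the numerical Grothendieck group. -/
def NumK0.of (E : C) : NumK0 K C := QuotientAddGroup.mk (K0.of E)

variable (C) in
/-- The Euler form on the numerical Grothendieck group. -/
def numEulerForm : NumK0 K C →+ NumK0 K C →+ ℤ :=
  QuotientAddGroup.lift (eulerKernel K C)
    { toFun := fun x => QuotientAddGroup.lift (eulerKernel K C) (eulerForm K C x)
        fun y hy => (hy x).2
      map_zero' := QuotientAddGroup.addMonoidHom_ext _ <| K0.hom_ext fun F => by
        change eulerForm K C 0 (K0.of F) = 0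
        simp
      map_add' := fun a b => QuotientAddGroup.addMonoidHom_ext _ <| K0.hom_ext fun F => by
        change eulerForm K C (a + b) (K0.of F) =
          eulerForm K C a (K0.of F) + eulerForm K C b (K0.of F)
        simp }
    fun x hx => QuotientAddGroup.addMonoidHom_ext _ <| K0.hom_ext fun F => (hx (K0.of F)).1

@[simp] lemma numEulerForm_of (E F : C) :
    numEulerForm K C (NumK0.of K E) (NumK0.of K F) = eulerObj K E F := by
  change eulerForm K C (K0.of E) (K0.of F) = _
  simp

end Grothendieck

/-! ### The universal cover of `GL₂⁺(ℝ)` -/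

/-- The unit vector `exp(iπφ)` of phase `φ`. -/
def phaseVec (φ : ℝ) : ℂ := Complex.exp (Real.pi * φ * Complex.I)

lemma exists_phase (z : ℂ) (hz : z ≠ 0) : ∃ φ : ℝ, ∃ c : ℝ, 0 < c ∧ z = c * phaseVec φ := by
  refine ⟨z.arg / Real.pi, ‖z‖, norm_pos_iff.mpr hz, ?_⟩
  have h : (Real.pi : ℂ) ≠ 0 := by exact_mod_cast Real.pi_ne_zero
  rw [phaseVec, Complex.ofReal_div, mul_div_cancel₀ _ h]
  exact (Complex.norm_mul_exp_arg_mul_I z).symm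

lemma phaseVec_ne_zero (φ : ℝ) : phaseVec φ ≠ 0 := Complex.exp_ne_zero _

lemma norm_phaseVec (φ : ℝ) : ‖phaseVec φ‖ = 1 := by
  rw [phaseVec, ← Complex.ofReal_mul, Complex.norm_exp_ofReal_mul_I]

/-- Two phases give the same ray of `ℂ` exactly when they differ by an even integer. -/
lemma phase_eq_of_ray {a b c d : ℝ} (hc : 0 < c) (hd : 0 < d)
    (h : (c : ℂ) * phaseVec a = d * phaseVec b) : ∃ n : ℤ, a = b + 2 * n := by
  have hcd : c = d := by
    have := congrArg norm h
    simpa [norm_phaseVec, abs_of_pos hc, abs_of_pos hd] using this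
  subst hcd
  have h2 : phaseVec a = phaseVec b :=
    mul_left_cancel₀ (by exact_mod_cast hc.ne') h
  obtain ⟨n, hn⟩ := Complex.exp_eq_exp_iff_exists_int.mp h2
  refine ⟨n, ?_⟩
  have h3 : ((Real.pi * a : ℝ) : ℂ) = ((Real.pi * (b + 2 * n) : ℝ) : ℂ) := by
    refine mul_right_cancel₀ Complex.I_ne_zero ?_
    push_cast
    rw [hn]
    ring
  exact mul_left_cancel₀ Real.pi_ne_zero (Complex.ofReal_injective h3)

/-- The universal cover of `GL₂⁺(ℝ)`: pairs `(g, M)` of an increasing function `g : ℝ → ℝ` with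
`g(φ + 1) = g(φ) + 1` and an orientation preserving `ℝ`-linear automorphism `M` of `ℂ = ℝ²`
which induce the same map on the circle `ℝ / 2ℤ = (ℝ² ∖ {0}) / ℝ_{>0}` of rays. -/
structure GL2PosCover where
  /-- the increasing function on phases -/
  g : ℝ → ℝ
  /-- the element of `GL₂⁺(ℝ)` -/
  M : ℂ ≃ₗ[ℝ] ℂ
  strictMono : StrictMono g
  map_add_one : ∀ φ, g (φ + 1) = g φ + 1
  det_pos : 0 < LinearMap.det (M : ℂ →ₗ[ℝ] ℂ)
  compat : ∀ φ, ∃ c : ℝ, 0 < c ∧ M (phaseVec φ) = c * phaseVec (g φ)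

namespace GL2PosCover

variable (γ : GL2PosCover)

lemma map_add_int (φ : ℝ) (n : ℤ) : γ.g (φ + n) = γ.g φ + n := by
  induction n using Int.induction_on with
  | zero => simp
  | succ i ih =>
    push_cast at ih ⊢
    rw [← add_assoc, γ.map_add_one, ih]
    ring
  | pred i ih =>
    have := γ.map_add_one (φ + ((-(i : ℤ) - 1 : ℤ) : ℝ))
    rw [show φ + ((-(i : ℤ) - 1 : ℤ) : ℝ) + 1 = φ + ((-(i : ℤ) : ℤ) : ℝ) by push_cast; ring, ih]
      at this
    push_cast at this ⊢
    linarith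

lemma surjective : Function.Surjective γ.g := by
  intro ψ
  obtain ⟨φ, c, hc, h⟩ := exists_phase (γ.M.symm (phaseVec ψ))
    (by simpa using phaseVec_ne_zero ψ)
  obtain ⟨d, hd, h'⟩ := γ.compat φ
  have h1 : phaseVec ψ = ((c * d : ℝ) : ℂ) * phaseVec (γ.g φ) := by
    rw [← γ.M.apply_symm_apply (phaseVec ψ), h, ← Complex.real_smul, map_smul, h',
      Complex.real_smul]
    push_cast
    ring
  obtain ⟨n, hn⟩ := phase_eq_of_ray (a := ψ) (b := γ.g φ) one_pos (mul_pos hc hd)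
    (by rw [← h1]; simp)
  refine ⟨φ + ((2 * n : ℤ) : ℝ), ?_⟩
  rw [γ.map_add_int, hn]
  push_cast
  ring

lemma exists_symm_ray (φ : ℝ) :
    ∃ c : ℝ, 0 < c ∧ γ.M.symm (phaseVec (γ.g φ)) = c * phaseVec φ := by
  obtain ⟨c, hc, h⟩ := γ.compat φ
  refine ⟨c⁻¹, inv_pos.mpr hc, ?_⟩
  have : γ.M.symm (M γ (phaseVec φ)) = c • γ.M.symm (phaseVec (γ.g φ)) := by
    rw [h, ← Complex.real_smul, map_smul]
  rw [LinearEquiv.symm_apply_apply] at this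
  rw [this, Complex.real_smul, ← mul_assoc, ← Complex.ofReal_mul, inv_mul_cancel₀ hc.ne']
  simp

end GL2PosCover

/-! ### Stability conditions -/

section Stability

variable (K : Type w) [Field K] (C : Type u) [Category.{v} C] [Preadditive C] [HasZeroObject C]
  [HasShift C ℤ] [∀ n : ℤ, (shiftFunctor C n).Additive] [Pretriangulated C]

variable {C} in
/-- `E` has a Harder–Narasimhan filtration with respect to the collection `P` of subcategories:
a chain `0 = X₀ ⟶ X₁ ⟶ ⋯ ⟶ Xₙ = E` whose cones are nonzero objects `Aᵢ ∈ P(φᵢ)` with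
`φ₀ > φ₁ > ⋯ > φₙ₋₁`. (The sequences are indexed by `ℕ`, only the indices up to `n` matter.) -/
def HasHNFiltration (P : ℝ → ObjectProperty C) (E : C) : Prop :=
  ∃ (n : ℕ) (X : ℕ → C) (f : ∀ i, X i ⟶ X (i + 1)) (φ : ℕ → ℝ),
    IsZero (X 0) ∧ Nonempty (X n ≅ E) ∧ (∀ i j, i < j → j < n → φ j < φ i) ∧
    ∀ i < n, ∃ (A : C) (g : X (i + 1) ⟶ A) (h : A ⟶ (X i)⟦(1 : ℤ)⟧),
      ¬ IsZero A ∧ P (φ i) A ∧ Triangle.mk (f i) g h ∈ distTriang C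

variable [Linear K C] [∀ n : ℤ, (shiftFunctor C n).Linear K] [IsOfFiniteType K C]

/-- A numerical Bridgeland stability condition `σ = (P, Z)`: a slicing `P` and a central charge `Z`
on the numerical Grothendieck group, satisfying the support property. The nonzero objects of
`P φ` are the `σ`-semistable objects of phase `φ`. (The heart of the associated bounded
t-structure is `P(0, 1]`.) -/
structure NumStabilityCondition where
  /-- the slicing; `P φ` is a strictly full additive subcategory -/
  P : ℝ → ObjectProperty C
  /-- the central charge -/
  Z : NumK0 K C →+ ℂ
  mem_of_iso : ∀ (φ : ℝ) (E F : C), Nonempty (E ≅ F) → P φ E → P φ F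
  mem_of_isZero : ∀ (φ : ℝ) (E : C), IsZero E → P φ E
  mem_biprod : ∀ (φ : ℝ) (E F : C), P φ E → P φ F → P φ (E ⊞ F)
  /-- `P(φ + 1) = P(φ)[1]` -/
  mem_shift_iff : ∀ (φ : ℝ) (E : C), P (φ + 1) (E⟦(1 : ℤ)⟧) ↔ P φ E
  hom_eq_zero : ∀ (φ ψ : ℝ) (E F : C), ψ < φ → P φ E → P ψ F → ∀ f : E ⟶ F, f = 0
  exists_hn : ∀ E : C, HasHNFiltration P E
  /-- a nonzero `E ∈ P φ` has `Z(E) ∈ ℝ_{>0} exp(iπφ)` -/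
  charge : ∀ (φ : ℝ) (E : C), P φ E → ¬ IsZero E →
    ∃ m : ℝ, 0 < m ∧ Z (NumK0.of K E) = m * phaseVec φ
  /-- the support property: some quadratic form on `N ⊗ ℝ` is negative definite on `ker Z` and
  nonnegative on the classes of semistable objects -/
  support : ∃ q : QuadraticForm ℝ (ℝ ⊗[ℤ] NumK0 K C),
    (∀ x, Z.toIntLinearMap.liftBaseChange ℝ x = 0 → x ≠ 0 → q x < 0) ∧
    ∀ (φ : ℝ) (E : C), P φ E → 0 ≤ q (1 ⊗ₜ NumK0.of K E)

variable {K C}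

/-- The right action `σ · γ = (P', Z')` of the universal cover of `GL₂⁺(ℝ)`, with
`P'(φ) = P(g(φ))` and `Z' = M⁻¹ ∘ Z` for `γ = (g, M)`. -/
def NumStabilityCondition.act (σ : NumStabilityCondition K C) (γ : GL2PosCover) :
    NumStabilityCondition K C where
  P φ := σ.P (γ.g φ)
  Z := (γ.M.symm : ℂ →ₗ[ℝ] ℂ).toAddMonoidHom.comp σ.Z
  mem_of_iso φ := σ.mem_of_iso _
  mem_of_isZero φ := σ.mem_of_isZero _
  mem_biprod φ := σ.mem_biprod _
  mem_shift_iff φ E := by rw [γ.map_add_one]; exact σ.mem_shift_iff _ E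
  hom_eq_zero φ ψ E F h := σ.hom_eq_zero _ _ E F (γ.strictMono h)
  exists_hn E := by
    obtain ⟨n, X, f, φ, h0, hn, hlt, h⟩ := σ.exists_hn E
    choose ψ hψ using fun i => γ.surjective (φ i)
    refine ⟨n, X, f, ψ, h0, hn, fun i j hij hj => ?_, fun i hi => ?_⟩
    · rw [← γ.strictMono.lt_iff_lt, hψ, hψ]
      exact hlt i j hij hj
    · obtain ⟨A, a, b, h1, h2, h3⟩ := h i hi
      exact ⟨A, a, b, h1, by simpa only [hψ] using h2, h3⟩
  charge φ E hE h0 := by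
    obtain ⟨m, hm, h⟩ := σ.charge _ E hE h0
    obtain ⟨c, hc, h'⟩ := γ.exists_symm_ray φ
    refine ⟨m * c, mul_pos hm hc, ?_⟩
    change γ.M.symm (σ.Z (NumK0.of K E)) = _
    rw [h, ← Complex.real_smul, map_smul, h', Complex.real_smul]
    push_cast
    ring
  support := by
    obtain ⟨q, hq, hq'⟩ := σ.support
    refine ⟨q, fun x hx => hq x ?_, fun φ E hE => hq' _ E hE⟩
    have key : ((γ.M.symm : ℂ →ₗ[ℝ] ℂ).toAddMonoidHom.comp σ.Z).toIntLinearMap.liftBaseChange ℝ =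
        (γ.M.symm : ℂ →ₗ[ℝ] ℂ) ∘ₗ σ.Z.toIntLinearMap.liftBaseChange ℝ := by
      ext x
      simp
    rw [key] at hx
    exact γ.M.symm.injective (by simpa using hx)

/-- `τ = Φ · σ` for an autoequivalence `Φ`, where `Φ · (P, Z) = (Φ(P), Z ∘ Φ_*⁻¹)`. Here `Φ(P)(φ)`
is the essential image of `P(φ)` under `Φ`, and the equality of central charges is tested on the
classes of objects, which generate the numerical Grothendieck group. -/
def IsImage (Φ : C ≌ C) (σ τ : NumStabilityCondition K C) : Prop :=
  (∀ φ : ℝ, τ.P φ = (σ.P φ).map Φ.functor) ∧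
    ∀ E : C, τ.Z (NumK0.of K E) = σ.Z (NumK0.of K (Φ.inverse.obj E))

end Stability

/-! ### Serre functors -/

section Serre

variable (K : Type w) [Field K] (C : Type u) [Category.{v} C] [Preadditive C] [Linear K C]

/-- A Serre functor on a `K`-linear category: a `K`-linear autoequivalence `S` with isomorphisms
`Hom(E, F) ≅ Hom(F, S E)^*`, natural in `E` and `F`. -/
structure SerreFunctor where
  /-- the autoequivalence `S` -/
  equiv : C ≌ C
  additive : equiv.functor.Additive
  linear : equiv.functor.Linear K
  /-- Serre duality -/
  duality : ∀ E F : C, (E ⟶ F) ≃ₗ[K] Module.Dual K (F ⟶ equiv.functor.obj E)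
  duality_comp_right : ∀ {E F F' : C} (f : E ⟶ F) (h : F ⟶ F') (u : F' ⟶ equiv.functor.obj E),
    duality E F' (f ≫ h) u = duality E F f (h ≫ u)
  duality_comp_left : ∀ {E E' F : C} (g : E' ⟶ E) (f : E ⟶ F) (u : F ⟶ equiv.functor.obj E'),
    duality E' F (g ≫ f) u = duality E F f (u ≫ equiv.functor.map g)

variable {K C} [HasZeroObject C] [HasShift C ℤ] [∀ n : ℤ, (shiftFunctor C n).Additive]
  [Pretriangulated C] [∀ n : ℤ, (shiftFunctor C n).Linear K] [IsOfFiniteType K C]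

/-- `σ` is Serre-invariant: `S · σ = σ · γ` for some `γ` in the universal cover of `GL₂⁺(ℝ)`. -/
def IsSerreInvariant (S : SerreFunctor K C) (σ : NumStabilityCondition K C) : Prop :=
  ∃ γ : GL2PosCover, IsImage S.equiv σ (σ.act γ)

end Serre

end StabCond

end

/-! Serre invariance controls phases. If `S · σ = σ · γ`, then `S` sends semistable objects of phase
`φ` to phase `γ.g φ`, and `S^r ≅ [k]` forces the `r`-th iterate of `γ.g` to add `k` to every phase
that occurs. Hence `S` raises phases by at most 2 (`SerreBound`), and Serre duality shows that a
nonzero map `E ⟶ F[i]` between semistable objects of phases `φ`, `ψ` requires `φ ≤ ψ + i ≤ φ + 2`.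
For semistable `E ≠ 0` this gives `χ(E, E) = hom⁰ - hom¹ + hom²`, so `hom¹(E, E) ≥ 1 - ℓ`. By the
weak Mukai lemma `hom¹` is superadditive along Harder–Narasimhan filtrations (`SerreBound.sum_le`),
so an object with `hom¹ < 2(1 - ℓ)` has a single factor: the objects of (C3) are semistable for
every Serre-invariant `σ` (`SerreBound.exists_P`).

Rigidity (`TestPair.eq`): let `σ`, `τ` have the same charge, and let `Q`, `Q'` with independent
charges have the same phases for both. If a common semistable `E` had different phases, these would
differ by a nonzero even integer, and the bounds above would force `χ(Q, E) = χ(Q', E) = 0`, hence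
`[E] = 0`, which is absurd. Induction on `hom¹(E, E)` then identifies all semistable objects.

It remains to find such a pair and to move `σ₂` so that charges and phases on it match those of `σ₁`
(`exists_eq_act`). This needs independent charges whose orientation is the same for `σ₁` and `σ₂`.
For `0 < k/r < 2` the pair is `Q`, `S Q`: independence is a computation with the Euler form
(`IsImage.cross_ne_zero`), and the orientation depends only on whether `k < r`. For `r = 2`, `k = 4`
the charges of `Q` and `S Q` are equal, so the pair is `Q₂`, `Q₁`. There `χ` is symmetric and
objects satisfying (*) are stable (`IsSerreInvariant.isSimpleAt`), so Schur's lemma makes the phase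
inequalities `p₂ < p₁ < p₂ + 1` strict. -/

namespace StabCond

/-! ### Vanishing of morphism groups -/

section NoHom

variable {C : Type u} [Category.{v} C] [Preadditive C]

/-- There are no nonzero morphisms from `E` to `F`. -/
def NoHom (E F : C) : Prop := ∀ f : E ⟶ F, f = 0

lemma NoHom.of_iso {E E' F F' : C} (e : E' ≅ E) (e' : F' ≅ F) (h : NoHom E F) : NoHom E' F' := by
  intro f
  have := h (e.inv ≫ f ≫ e'.hom)
  rw [← cancel_epi e.inv, ← cancel_mono e'.hom]
  simpa using this

lemma NoHom.of_isZero_left {E F : C} (h : IsZero E) : NoHom E F := fun _ => h.eq_of_src _ _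

lemma NoHom.of_isZero_right {E F : C} (h : IsZero F) : NoHom E F := fun _ => h.eq_of_tgt _ _

lemma NoHom.isZero {E : C} (h : NoHom E E) : IsZero E := (IsZero.iff_id_eq_zero E).2 (h _)

variable [HasShift C ℤ] [∀ n : ℤ, (shiftFunctor C n).Additive]

lemma noHom_shift_iff (n : ℤ) {E F : C} : NoHom (E⟦n⟧) (F⟦n⟧) ↔ NoHom E F := by
  constructor
  · intro h f
    apply (shiftFunctor C n).map_injective
    exact (h ((shiftFunctor C n).map f)).trans (Functor.map_zero _ _ _).symm
  · intro h f
    rw [← (shiftFunctor C n).map_preimage f, h ((shiftFunctor C n).preimage f), Functor.map_zero]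

lemma NoHom.shift (n : ℤ) {E F : C} (h : NoHom E F) : NoHom (E⟦n⟧) (F⟦n⟧) :=
  (noHom_shift_iff n).2 h

lemma noHom_shift_right_iff {n m : ℤ} (h : n + m = 0) {E F : C} :
    NoHom E (F⟦m⟧) ↔ NoHom (E⟦n⟧) F := by
  have e : (F⟦m⟧)⟦n⟧ ≅ F := (shiftFunctorCompIsoId C m n (by omega)).app F
  rw [← noHom_shift_iff n]
  exact ⟨NoHom.of_iso (Iso.refl _) e.symm, NoHom.of_iso (Iso.refl _) e⟩

variable [HasZeroObject C] [Pretriangulated C]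

lemma NoHom.ext_left {T : Triangle C} (hT : T ∈ distTriang C) {F : C} (h₁ : NoHom T.obj₁ F)
    (h₃ : NoHom T.obj₃ F) : NoHom T.obj₂ F := by
  intro f
  obtain ⟨g, rfl⟩ := T.yoneda_exact₂ hT f (h₁ _)
  rw [h₃ g, comp_zero]

lemma NoHom.ext_right {T : Triangle C} (hT : T ∈ distTriang C) {F : C} (h₁ : NoHom F T.obj₁)
    (h₃ : NoHom F T.obj₃) : NoHom F T.obj₂ := by
  intro f
  obtain ⟨g, rfl⟩ := T.coyoneda_exact₂ hT f (h₃ _)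
  rw [h₁ g, zero_comp]

end NoHom

/-! ### Dimensions of morphism spaces -/

section HomDim

variable (K : Type w) [Field K] {C : Type u} [Category.{v} C] [Preadditive C] [Linear K C]
  [HasShift C ℤ]

lemma homDim_eq_zero {E F : C} {i : ℤ} (h : NoHom E (F⟦i⟧)) : homDim K E F i = 0 := by
  have : Subsingleton (E ⟶ F⟦i⟧) := ⟨fun f g => by rw [h f, h g]⟩
  exact Module.finrank_zero_of_subsingleton

lemma homDim_pos [IsOfFiniteType K C] {E F : C} {i : ℤ} (h : ¬ NoHom E (F⟦i⟧)) :
    0 < homDim K E F i := by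
  have := IsOfFiniteType.finite_hom (K := K) E (F⟦i⟧)
  simp only [NoHom, not_forall] at h
  obtain ⟨f, hf⟩ := h
  have : Nontrivial (E ⟶ F⟦i⟧) := ⟨f, 0, hf⟩
  exact Module.finrank_pos

lemma homDim_congr_right {E F F' : C} {i j : ℤ} (e : F⟦i⟧ ≅ F'⟦j⟧) :
    homDim K E F i = homDim K E F' j :=
  (Linear.homCongr K (Iso.refl E) e).finrank_eq

lemma homDim_shift_right (E F : C) (n i : ℤ) : homDim K E (F⟦n⟧) i = homDim K E F (n + i) :=
  homDim_congr_right K ((shiftFunctorAdd' C n i (n + i) rfl).app F).symm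

lemma homDim_zero_eq (E F : C) : homDim K E F 0 = Module.finrank K (E ⟶ F) :=
  (Linear.homCongr K (Iso.refl E) ((shiftFunctorZero C ℤ).app F)).finrank_eq

lemma one_le_homDim_zero [IsOfFiniteType K C] {E : C} (hE : ¬ IsZero E) :
    1 ≤ homDim K E E 0 := by
  refine homDim_pos K fun h => hE ?_
  exact (h.of_iso (Iso.refl E) ((shiftFunctorZero C ℤ).app E).symm).isZero

lemma eulerObj_eq_of_support {E F : C} (s : Finset ℤ) (h : ∀ i ∉ s, homDim K E F i = 0) :
    eulerObj K E F = ∑ i ∈ s, (i.negOnePow : ℤ) * (homDim K E F i : ℤ) := by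
  refine finsum_eq_sum_of_support_subset _ fun i hi => ?_
  by_contra h'
  simp [h i (by simpa using h')] at hi

lemma eulerObj_eq_single {E F : C} (n : ℤ) (h : ∀ i ≠ n, homDim K E F i = 0) :
    eulerObj K E F = (n.negOnePow : ℤ) * (homDim K E F n : ℤ) := by
  rw [eulerObj_eq_of_support K {n} (by simpa using h)]
  simp

lemma eulerObj_eq_three {E F : C} (h : ∀ i, i < 0 ∨ 2 < i → homDim K E F i = 0) :
    eulerObj K E F = homDim K E F 0 - homDim K E F 1 + homDim K E F 2 := by
  rw [eulerObj_eq_of_support K {0, 1, 2}]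
  · rw [Finset.sum_insert (by decide), Finset.sum_insert (by decide), Finset.sum_singleton]
    have h2 : (2 : ℤ).negOnePow = 1 := by decide
    simp [h2]
    ring
  · intro i hi
    simp only [Finset.mem_insert, Finset.mem_singleton, not_or] at hi
    exact h i (by omega)

lemma exists_not_noHom_of_eulerObj_ne_zero {E F : C} (h : eulerObj K E F ≠ 0) :
    ∃ i : ℤ, ¬ NoHom E (F⟦i⟧) := by
  by_contra! h'
  refine h ?_
  rw [eulerObj_eq_of_support K ∅ fun i _ => homDim_eq_zero K (h' i)]
  simp

end HomDim

/-! ### Serre duality -/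

section SerreDuality

variable {K : Type w} [Field K] {C : Type u} [Category.{v} C] [Preadditive C] [Linear K C]
  (S : SerreFunctor K C)

lemma SerreFunctor.noHom_of {E F : C} (h : NoHom F (S.equiv.functor.obj E)) : NoHom E F := by
  intro f
  apply (S.duality E F).injective
  ext u
  rw [h u, map_zero, map_zero]

lemma SerreFunctor.isZero_iff {E : C} :
    IsZero (S.equiv.functor.obj E) ↔ IsZero E :=
  ⟨IsZero.of_full_of_faithful_of_isZero _ _, S.equiv.functor.map_isZero⟩

lemma SerreFunctor.finrank_hom (E F : C) :
    Module.finrank K (E ⟶ F) = Module.finrank K (F ⟶ S.equiv.functor.obj E) := by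
  rw [(S.duality E F).finrank_eq, Subspace.dual_finrank_eq]

variable [HasShift C ℤ] [∀ n : ℤ, (shiftFunctor C n).Additive]
  [∀ n : ℤ, (shiftFunctor C n).Linear K]

lemma SerreFunctor.homDim_eq (E F : C) (i : ℤ) :
    homDim K E F i = homDim K F (S.equiv.functor.obj E) (-i) := by
  rw [homDim_eq_left F, neg_neg]
  exact S.finrank_hom E (F⟦i⟧)

lemma SerreFunctor.eulerObj_eq (E F : C) :
    eulerObj K F (S.equiv.functor.obj E) = eulerObj K E F := by
  rw [eulerObj, eulerObj, ← finsum_comp_equiv (Equiv.neg ℤ)]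
  refine finsum_congr fun i => ?_
  rw [S.homDim_eq E F i]
  simp [Int.negOnePow_neg]

end SerreDuality

/-! ### Classes in the numerical Grothendieck group -/

section Classes

variable (K : Type w) [Field K] {C : Type u} [Category.{v} C] [Preadditive C] [HasZeroObject C]
  [HasShift C ℤ] [∀ n : ℤ, (shiftFunctor C n).Additive] [Pretriangulated C]

lemma K0.of_triangle (T : Triangle C) (hT : T ∈ distTriang C) :
    K0.of T.obj₂ = K0.of T.obj₁ + K0.of T.obj₃ := by
  have : FreeAbelianGroup.of T.obj₂ - FreeAbelianGroup.of T.obj₁ - FreeAbelianGroup.of T.obj₃ ∈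
      k0Relations C := AddSubgroup.subset_closure ⟨T, hT, rfl⟩
  have h := (QuotientAddGroup.eq_zero_iff _).2 this
  rw [QuotientAddGroup.mk_sub, QuotientAddGroup.mk_sub, sub_sub, sub_eq_zero] at h
  exact h

variable [Linear K C] [∀ n : ℤ, (shiftFunctor C n).Linear K] [IsOfFiniteType K C]

lemma NumK0.of_triangle (T : Triangle C) (hT : T ∈ distTriang C) :
    NumK0.of K T.obj₂ = NumK0.of K T.obj₁ + NumK0.of K T.obj₃ := by
  simp only [NumK0.of, K0.of_triangle T hT, QuotientAddGroup.mk_add]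

/-- The free group is on objects rather than isomorphism classes, so this needs a proof: `E ⟶ E` and
`E ⟶ F` both complete to triangles with the same zero object as cone. -/
lemma NumK0.of_iso {E F : C} (e : E ≅ F) : NumK0.of K E = NumK0.of K F := by
  have h := NumK0.of_triangle K (contractibleTriangle E) (contractible_distinguished E)
  have h' := NumK0.of_triangle K (Triangle.mk e.hom (0 : F ⟶ (contractibleTriangle E).obj₃) 0)
    ((Triangle.distinguished_iff_of_isZero₃ _ (isZero_zero C)).2 (inferInstanceAs (IsIso e.hom)))
  exact h.trans h'.symm

lemma NumK0.of_isZero {E : C} (h : IsZero E) : NumK0.of K E = 0 := by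
  have h' := NumK0.of_triangle K (contractibleTriangle E) (contractible_distinguished E)
  have e : (contractibleTriangle E).obj₃ ≅ E := (isZero_zero C).iso h
  rw [NumK0.of_iso K e] at h'
  simpa using h'

lemma NumK0.of_shift_one (E : C) : NumK0.of K (E⟦(1 : ℤ)⟧) = -NumK0.of K E := by
  have h := NumK0.of_triangle K _ (rot_of_distTriang _ (contractible_distinguished E))
  have h0 : NumK0.of K (contractibleTriangle E).rotate.obj₂ = 0 :=
    NumK0.of_isZero K (isZero_zero C)
  rw [h0] at h
  exact (neg_eq_of_add_eq_zero_right h.symm).symm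

lemma NumK0.of_shift (E : C) (n : ℤ) :
    NumK0.of K (E⟦n⟧) = (n.negOnePow : ℤ) • NumK0.of K E := by
  induction n using Int.induction_on with
  | zero => simpa using NumK0.of_iso K ((shiftFunctorZero C ℤ).app E)
  | succ n ih =>
    rw [NumK0.of_iso K ((shiftFunctorAdd C (n : ℤ) 1).app E)]
    simp only [Functor.comp_obj]
    rw [NumK0.of_shift_one, ih, Int.negOnePow_succ]
    simp
  | pred n ih =>
    rw [NumK0.of_iso K ((shiftFunctorAdd' C (-(n : ℤ) - 1) 1 (-(n : ℤ)) (by ring)).app E)] at ih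
    simp only [Functor.comp_obj] at ih
    rw [NumK0.of_shift_one] at ih
    rw [Int.negOnePow_sub, ← neg_inj, ih]
    simp

end Classes

/-! ### Negative definite forms on groups of rank two -/

section Lattice

variable {N : Type*} [AddCommGroup N] {B : N →+ N →+ ℤ} (hB : ∀ v, v ≠ 0 → B v v < 0)

include hB in
-- Definiteness rules out torsion, which the rank hypothesis does not.
lemma eq_zero_of_zsmul_eq_zero {n : ℤ} (hn : n ≠ 0) {x : N} (h : n • x = 0) : x = 0 := by
  by_contra h0
  have : B (n • x) x = 0 := by rw [h]; simp
  rw [map_zsmul, AddMonoidHom.zsmul_apply, smul_eq_mul] at this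
  exact (hB x h0).ne ((mul_eq_zero.1 this).resolve_left hn)

/-- `v` and `w` satisfy no nontrivial integral relation. -/
def Indep (v w : N) : Prop := ∀ a b : ℤ, a • v + b • w = 0 → a = 0 ∧ b = 0

/-- A substitute for coordinates: only the rank of `N` is known, so `x` lies in the span of `v`, `w`
only after multiplication by some `n ≠ 0`. -/
lemma exists_relation (hN : Module.finrank ℤ N = 2) {v w : N} (h : Indep v w) (x : N) :
    ∃ n a b : ℤ, n ≠ 0 ∧ n • x = a • v + b • w := by
  have hr : Module.rank ℤ N = 2 := (Module.rank_eq_ofNat_iff_finrank_eq_ofNat 2).2 hN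
  have h3 : ¬ LinearIndependent ℤ ![x, v, w] := by
    intro h3
    have := h3.cardinal_lift_le_rank
    rw [hr] at this
    simp only [Cardinal.mk_fin, Cardinal.lift_natCast, Cardinal.lift_ofNat] at this
    exact absurd this (by exact_mod_cast (by norm_num : ¬ (3 ≤ 2)))
  rw [Fintype.not_linearIndependent_iff] at h3
  obtain ⟨g, hg, i, hi⟩ := h3
  simp only [Fin.sum_univ_three, Matrix.cons_val_zero, Matrix.cons_val_one, Matrix.cons_val] at hg
  refine ⟨g 0, -g 1, -g 2, fun h0 => ?_, ?_⟩
  · rw [h0, zero_smul, zero_add] at hg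
    obtain ⟨h1, h2⟩ := h _ _ hg
    fin_cases i <;> simp_all
  · rw [neg_smul, neg_smul, ← neg_add, eq_neg_iff_add_eq_zero, ← hg]
    abel

lemma exists_indep (hN : Module.finrank ℤ N = 2) : ∃ v w : N, Indep v w := by
  obtain ⟨f, hf⟩ := exists_linearIndependent_of_le_finrank hN.ge
  rw [Fintype.linearIndependent_iff] at hf
  refine ⟨f 0, f 1, fun a b h => ?_⟩
  have := hf ![a, b] (by simpa [Fin.sum_univ_two] using h)
  exact ⟨this 0, this 1⟩

include hB in
lemma Indep.eq_zero_of_orthogonal (hN : Module.finrank ℤ N = 2) {v w : N} (h : Indep v w) {x : N}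
    (hv : B v x = 0) (hw : B w x = 0) : x = 0 := by
  obtain ⟨n, a, b, hn, hx⟩ := exists_relation hN h x
  by_contra h0
  have : B (n • x) x = 0 := by rw [hx]; simp [hv, hw]
  rw [map_zsmul, AddMonoidHom.zsmul_apply, smul_eq_mul] at this
  exact (hB x h0).ne ((mul_eq_zero.1 this).resolve_left hn)

end Lattice

end StabCond

namespace StabCond

/-! ### The weak Mukai lemma -/

section Mukai

variable (K : Type w) [Field K] {C : Type u} [Category.{v} C] [Preadditive C] [Linear K C]
  [HasZeroObject C] [HasShift C ℤ] [∀ n : ℤ, (shiftFunctor C n).Additive]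
  [Pretriangulated C]

/-- Degree one endomorphisms of a triangle, ignoring the compatibility with the connecting map. -/
def degreeOneEnd (T : Triangle C) : Submodule K ((T.obj₁ ⟶ T.obj₁⟦(1 : ℤ)⟧) ×
    (T.obj₃ ⟶ T.obj₃⟦(1 : ℤ)⟧) × (T.obj₂ ⟶ T.obj₂⟦(1 : ℤ)⟧)) where
  carrier := {x | T.mor₁ ≫ x.2.2 = x.1 ≫ T.mor₁⟦(1 : ℤ)⟧' ∧
    T.mor₂ ≫ x.2.1 = x.2.2 ≫ T.mor₂⟦(1 : ℤ)⟧'}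
  zero_mem' := by simp
  add_mem' := by
    rintro a b ⟨h1, h2⟩ ⟨h3, h4⟩
    exact ⟨by simp [h1, h3], by simp [h2, h4]⟩
  smul_mem' := by
    rintro c a ⟨h1, h2⟩
    exact ⟨by simp [h1], by simp [h2]⟩

/-- The weak Mukai lemma. -/
lemma homDim_one_add_le [IsOfFiniteType K C] (T : Triangle C) (hT : T ∈ distTriang C)
    (h13 : NoHom T.obj₁ T.obj₃) (h31 : NoHom T.obj₃ (T.obj₁⟦(2 : ℤ)⟧)) :
    homDim K T.obj₁ T.obj₁ 1 + homDim K T.obj₃ T.obj₃ 1 ≤ homDim K T.obj₂ T.obj₂ 1 := by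
  have := fun E F : C => IsOfFiniteType.finite_hom (K := K) E F
  have h31' : NoHom T.obj₃ ((T.obj₁⟦(1 : ℤ)⟧)⟦(1 : ℤ)⟧) :=
    h31.of_iso (Iso.refl _) ((shiftFunctorAdd' C 1 1 2 (by norm_num)).app T.obj₁).symm
  let G := degreeOneEnd K T
  let p : G →ₗ[K] (T.obj₂ ⟶ T.obj₂⟦(1 : ℤ)⟧) :=
    (LinearMap.snd K _ _ ∘ₗ LinearMap.snd K _ _) ∘ₗ G.subtype
  let q : G →ₗ[K] (T.obj₁ ⟶ T.obj₁⟦(1 : ℤ)⟧) × (T.obj₃ ⟶ T.obj₃⟦(1 : ℤ)⟧) :=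
    ((LinearMap.fst K _ _).prod (LinearMap.fst K _ _ ∘ₗ LinearMap.snd K _ _)) ∘ₗ G.subtype
  have hp : Function.Injective p := by
    rw [injective_iff_map_eq_zero]
    -- If `u = 0`, then `a` and `b` factor through maps `T.obj₁ ⟶ T.obj₃` and the shift of such a
    -- map, which vanish by `h13`.
    rintro ⟨⟨a, b, u⟩, h1, h2⟩ (hu : u = 0)
    subst hu
    obtain ⟨g, rfl⟩ := T.coyoneda_exact₁ hT a (h1.symm.trans comp_zero)
    obtain ⟨g', rfl⟩ := T.yoneda_exact₃ hT b (h2.trans zero_comp)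
    simp [h13 g, h13.shift 1 g']
  have hq : Function.Surjective q := by
    rintro ⟨a, b⟩
    -- Rotating three times shifts the triangle by one and changes the signs of its maps, so `-u` is
    -- the endomorphism wanted. The square needed to complete `(a, b)` commutes because both
    -- composites lie in `Hom(T.obj₃, T.obj₁[2]) = 0`.
    obtain ⟨u, hu, hu'⟩ : ∃ u : T.obj₂ ⟶ T.obj₂⟦(1 : ℤ)⟧,
        T.mor₁ ≫ u = a ≫ (-T.mor₁⟦(1 : ℤ)⟧') ∧ T.mor₂ ≫ b = u ≫ (-T.mor₂⟦(1 : ℤ)⟧') :=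
      complete_distinguished_triangle_morphism₂ T T.rotate.rotate.rotate hT
        (rot_of_distTriang _ (rot_of_distTriang _ (rot_of_distTriang _ hT))) a b
        ((h31' _).trans (h31' _).symm)
    refine ⟨⟨(a, b, -u), ?_, ?_⟩, rfl⟩
    · simp [hu]
    · simp [hu']
  have e1 := LinearMap.finrank_le_finrank_of_injective hp
  have e2 := q.finrank_range_add_finrank_ker
  rw [LinearMap.range_eq_top.2 hq, finrank_top, Module.finrank_prod] at e2
  simp only [homDim]
  omega

end Mukai

/-! ### Harder–Narasimhan filtrations -/

section HN

variable {C : Type u} [Category.{v} C] [Preadditive C] [HasZeroObject C]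
  [HasShift C ℤ] [∀ n : ℤ, (shiftFunctor C n).Additive] [Pretriangulated C]

/-- `HN P l E`: the object `E` has a Harder–Narasimhan filtration whose list of phases and factors
is `l`, starting with the factor of least phase. -/
inductive HN (P : ℝ → ObjectProperty C) : List (ℝ × C) → C → Prop
  | zero {E : C} : IsZero E → HN P [] E
  | cons {l : List (ℝ × C)} {φ : ℝ} (T : Triangle C) : T ∈ distTriang C → HN P l T.obj₁ →
      ¬ IsZero T.obj₃ → P φ T.obj₃ → (∀ x ∈ l, φ < x.1) → HN P ((φ, T.obj₃) :: l) T.obj₂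

lemma HN.isZero {P : ℝ → ObjectProperty C} {E : C} (h : HN P [] E) : IsZero E := by
  cases h with
  | zero h0 => exact h0

lemma HN.of_iso {P : ℝ → ObjectProperty C} {l : List (ℝ × C)} {E F : C} (h : HN P l E)
    (e : E ≅ F) : HN P l F := by
  cases h with
  | zero h0 => exact .zero (h0.of_iso e.symm)
  | cons T hT h1 h2 h3 h4 =>
    exact .cons (Triangle.mk (T.mor₁ ≫ e.hom) (e.inv ≫ T.mor₂) T.mor₃)
      (isomorphic_distinguished _ hT _ (Triangle.isoMk _ _ (Iso.refl _) e.symm (Iso.refl _)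
        (show (T.mor₁ ≫ e.hom) ≫ e.inv = 𝟙 T.obj₁ ≫ T.mor₁ by simp)
        (show (e.inv ≫ T.mor₂) ≫ 𝟙 T.obj₃ = e.inv ≫ T.mor₂ by simp)
        (show T.mor₃ ≫ (𝟙 T.obj₁)⟦(1 : ℤ)⟧' = 𝟙 T.obj₃ ≫ T.mor₃ by simp)))
      h1 h2 h3 h4

/-- Passes to the inductive form `HN`, so that filtrations can be handled by structural induction.
-/
lemma HasHNFiltration.exists_list {P : ℝ → ObjectProperty C} {E : C} (h : HasHNFiltration P E) :
    ∃ l, HN P l E := by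
  obtain ⟨n, X, f, φ, h0, ⟨e⟩, hlt, h⟩ := h
  have key : ∀ m ≤ n, ∃ l, HN P l (X m) ∧ ∀ x ∈ l, ∃ i < m, x.1 = φ i := by
    intro m
    induction m with
    | zero => exact fun _ => ⟨[], .zero h0, by simp⟩
    | succ m ih =>
      intro hm
      obtain ⟨l, hl, hl'⟩ := ih (by omega)
      obtain ⟨A, g, k, hA, hPA, hT⟩ := h m (by omega)
      refine ⟨(φ m, A) :: l, .cons _ hT hl hA hPA fun x hx => ?_, ?_⟩
      · obtain ⟨i, hi, hxi⟩ := hl' x hx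
        rw [hxi]
        exact hlt i m hi (by omega)
      · intro x hx
        rcases List.mem_cons.1 hx with rfl | hx
        · exact ⟨m, by omega, rfl⟩
        · obtain ⟨i, hi, hxi⟩ := hl' x hx
          exact ⟨i, by omega, hxi⟩
  obtain ⟨l, hl, -⟩ := key n le_rfl
  exact ⟨l, hl.of_iso e⟩

variable {P : ℝ → ObjectProperty C} {l : List (ℝ × C)} {E F : C}

lemma HN.mem (h : HN P l E) : ∀ x ∈ l, P x.1 x.2 ∧ ¬ IsZero x.2 := by
  induction h with
  | zero => simp
  | cons T _ _ h2 h3 _ ih =>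
    intro x hx
    rcases List.mem_cons.1 hx with rfl | hx
    · exact ⟨h3, h2⟩
    · exact ih x hx

lemma HN.noHom_left (h : HN P l E) (hF : ∀ x ∈ l, NoHom x.2 F) : NoHom E F := by
  induction h with
  | zero h0 => exact .of_isZero_left h0
  | cons T hT _ _ _ _ ih =>
    exact .ext_left hT (ih fun x hx => hF x (List.mem_cons_of_mem _ hx))
      (hF _ List.mem_cons_self)

lemma HN.noHom_right (h : HN P l E) (hF : ∀ x ∈ l, NoHom F x.2) : NoHom F E := by
  induction h with
  | zero h0 => exact .of_isZero_right h0
  | cons T hT _ _ _ _ ih =>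
    exact .ext_right hT (ih fun x hx => hF x (List.mem_cons_of_mem _ hx))
      (hF _ List.mem_cons_self)

lemma HN.noHom_right_shift (h : HN P l E) (n : ℤ) (hF : ∀ x ∈ l, NoHom F (x.2⟦n⟧)) :
    NoHom F (E⟦n⟧) := by
  rw [noHom_shift_right_iff (n := -n) (by omega)]
  exact h.noHom_right fun x hx => (noHom_shift_right_iff (n := -n) (by omega)).1 (hF x hx)

lemma HN.mono {P' : ℝ → ObjectProperty C} (h : HN P l E) (hP : ∀ x ∈ l, P' x.1 x.2) :
    HN P' l E := by
  induction h with
  | zero h0 => exact .zero h0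
  | cons T hT _ h2 _ h4 ih =>
    exact .cons T hT (ih fun x hx => hP x (List.mem_cons_of_mem _ hx)) h2
      (hP _ List.mem_cons_self) h4

end HN

/-! ### Slicings -/

section Slicing

variable {K : Type w} [Field K] {C : Type u} [Category.{v} C] [Preadditive C] [HasZeroObject C]
  [HasShift C ℤ] [∀ n : ℤ, (shiftFunctor C n).Additive] [Pretriangulated C]
  [Linear K C] [∀ n : ℤ, (shiftFunctor C n).Linear K] [IsOfFiniteType K C]

namespace NumStabilityCondition

variable (σ : NumStabilityCondition K C)

lemma P_of_iso {φ : ℝ} {E F : C} (e : E ≅ F) (h : σ.P φ E) : σ.P φ F :=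
  σ.mem_of_iso _ _ _ ⟨e⟩ h

lemma P_shift_iff {φ : ℝ} {E : C} (n : ℤ) : σ.P (φ + n) (E⟦n⟧) ↔ σ.P φ E := by
  induction n using Int.induction_on with
  | zero =>
    have e : E⟦(0 : ℤ)⟧ ≅ E := (shiftFunctorZero C ℤ).app E
    simpa using ⟨σ.P_of_iso e, σ.P_of_iso e.symm⟩
  | succ n ih =>
    have e : E⟦((n : ℤ) + 1)⟧ ≅ (E⟦(n : ℤ)⟧)⟦(1 : ℤ)⟧ := (shiftFunctorAdd C (n : ℤ) 1).app E
    rw [← ih, ← σ.mem_shift_iff (φ + ((n : ℤ) : ℝ))]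
    push_cast
    rw [add_assoc]
    exact ⟨σ.P_of_iso e, σ.P_of_iso e.symm⟩
  | pred n ih =>
    have e : E⟦-(n : ℤ)⟧ ≅ (E⟦(-(n : ℤ) - 1)⟧)⟦(1 : ℤ)⟧ :=
      (shiftFunctorAdd' C (-(n : ℤ) - 1) 1 (-(n : ℤ)) (by ring)).app E
    rw [← ih, ← σ.mem_shift_iff (φ + ((-(n : ℤ) - 1 : ℤ) : ℝ))]
    push_cast
    rw [show φ + (-(n : ℝ) - 1) + 1 = φ + -(n : ℝ) by ring]
    exact ⟨σ.P_of_iso e.symm, σ.P_of_iso e⟩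

lemma P_shift {φ : ℝ} {E : C} (n : ℤ) (h : σ.P φ E) : σ.P (φ + n) (E⟦n⟧) :=
  (σ.P_shift_iff n).2 h

lemma exists_HN (E : C) : ∃ l, HN σ.P l E := (σ.exists_hn E).exists_list

variable {σ}

lemma noHom {φ ψ : ℝ} {E F : C} (hE : σ.P φ E) (hF : σ.P ψ F) (h : ψ < φ) : NoHom E F :=
  σ.hom_eq_zero φ ψ E F h hE hF

lemma noHom_shift {φ ψ : ℝ} {E F : C} (hE : σ.P φ E) (hF : σ.P ψ F) {n : ℤ} (h : ψ + n < φ) :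
    NoHom E (F⟦n⟧) :=
  noHom hE (σ.P_shift n hF) h

lemma le_of_not_noHom {φ ψ : ℝ} {E F : C} (hE : σ.P φ E) (hF : σ.P ψ F) (h : ¬ NoHom E F) :
    φ ≤ ψ := by
  by_contra! h'
  exact h (noHom hE hF h')

lemma phase_unique {φ ψ : ℝ} {E : C} (hφ : σ.P φ E) (hψ : σ.P ψ E) (hE : ¬ IsZero E) : φ = ψ :=
  le_antisymm (le_of_not_noHom hφ hψ fun h => hE h.isZero)
    (le_of_not_noHom hψ hφ fun h => hE h.isZero)

lemma Z_ne_zero {φ : ℝ} {E : C} (h : σ.P φ E) (hE : ¬ IsZero E) : σ.Z (NumK0.of K E) ≠ 0 := by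
  obtain ⟨m, hm, h'⟩ := σ.charge φ E h hE
  rw [h']
  exact mul_ne_zero (by exact_mod_cast hm.ne') (phaseVec_ne_zero _)

lemma of_ne_zero {φ : ℝ} {E : C} (h : σ.P φ E) (hE : ¬ IsZero E) : NumK0.of K E ≠ 0 := by
  intro h0
  exact Z_ne_zero h hE (by rw [h0, map_zero])

variable {l : List (ℝ × C)} {E F : C}

/-- An object with a nonempty Harder–Narasimhan filtration receives a nonzero map from its factor
of largest phase. -/
lemma HN_exists_max (h : HN σ.P l E) (hl : l ≠ []) :
    ∃ x ∈ l, (∀ y ∈ l, y.1 ≤ x.1) ∧ ¬ NoHom x.2 E := by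
  induction h with
  | zero => exact absurd rfl hl
  | @cons l φ T hT h1 h2 h3 h4 ih =>
    by_cases h : l = []
    · subst h
      refine ⟨_, List.mem_cons_self, by simp, fun hn => h2 ?_⟩
      have := (T.isZero₁_iff_isIso₂ hT).1 h1.isZero
      exact (hn.of_iso (Iso.refl _) (asIso T.mor₂).symm).isZero
    · obtain ⟨x, hx, hmax, hx'⟩ := ih h
      refine ⟨x, List.mem_cons_of_mem _ hx, ?_, fun hn => hx' fun f => ?_⟩
      · intro y hy
        rcases List.mem_cons.1 hy with rfl | hy
        · exact (h4 x hx).le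
        · exact hmax y hy
      -- A map from the top factor to `T.obj₁` that dies in `T.obj₂` comes from `T.obj₃[-1]`, whose
      -- phase is too small to receive it.
      · obtain ⟨g, rfl⟩ := T.invRotate.coyoneda_exact₂ (inv_rot_of_distTriang _ hT) f (hn _)
        have : NoHom x.2 (T.obj₃⟦(-1 : ℤ)⟧) :=
          noHom_shift (h1.mem x hx).1 h3 (by push_cast; linarith [h4 x hx])
        exact (congrArg (· ≫ _) (this g)).trans zero_comp

/-- The map from an object to its Harder–Narasimhan factor of least phase is nonzero. -/
lemma HN_mor₂_ne_zero {φ : ℝ} {T : Triangle C} (hT : T ∈ distTriang C) (h : HN σ.P l T.obj₁)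
    (h0 : ¬ IsZero T.obj₃) (hP : σ.P φ T.obj₃) (hl : ∀ x ∈ l, φ < x.1) : T.mor₂ ≠ 0 := by
  intro hz
  refine h0 (IsZero.iff_id_eq_zero _ |>.2 ?_)
  obtain ⟨g, hg⟩ := T.yoneda_exact₃ hT (𝟙 _) (by rw [hz, zero_comp])
  have : NoHom (T.obj₁⟦(1 : ℤ)⟧) T.obj₃ := by
    rw [← noHom_shift_right_iff (m := -1) (by norm_num)]
    exact h.noHom_left fun x hx =>
      noHom_shift (h.mem x hx).1 hP (by push_cast; linarith [hl x hx])
  rw [hg, this g, comp_zero]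

lemma HN_le_of_noHom {a : ℝ} (h : HN σ.P l E) (hE : ∀ ψ D, ψ < a → σ.P ψ D → NoHom E D) :
    ∀ x ∈ l, a ≤ x.1 := by
  cases h with
  | zero => simp
  | @cons l φ T hT h1 h2 h3 h4 =>
    have : a ≤ φ := by
      by_contra! h
      exact HN_mor₂_ne_zero hT h1 h2 h3 h4 (hE _ _ h h3 _)
    intro x hx
    rcases List.mem_cons.1 hx with rfl | hx
    · exact this
    · exact this.trans (h4 x hx).le

lemma HN_ge_of_noHom {b : ℝ} (h : HN σ.P l E) (hE : ∀ ψ D, b < ψ → σ.P ψ D → NoHom D E) :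
    ∀ x ∈ l, x.1 ≤ b := by
  intro y hy
  obtain ⟨x, hx, hmax, hx'⟩ := HN_exists_max h (List.ne_nil_of_mem hy)
  refine (hmax y hy).trans ?_
  by_contra! h'
  exact hx' (hE _ _ h' (h.mem x hx).1)

/-- An object all of whose Harder–Narasimhan phases are equal to `a` is semistable. -/
lemma P_of_HN {a : ℝ} (h : HN σ.P l E) (hl : ∀ x ∈ l, x.1 = a) : σ.P a E := by
  cases h with
  | zero h0 => exact σ.mem_of_isZero _ _ h0
  | @cons l φ T hT h1 h2 h3 h4 =>
    have hφ : φ = a := hl (φ, T.obj₃) List.mem_cons_self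
    cases l with
    | nil =>
      have := (T.isZero₁_iff_isIso₂ hT).1 h1.isZero
      rw [← hφ]
      exact σ.P_of_iso (asIso T.mor₂).symm h3
    | cons x l =>
      have h5 := h4 x List.mem_cons_self
      rw [hφ, hl x (by simp)] at h5
      exact absurd h5 (lt_irrefl a)

/-- Orthogonality to smaller and larger phases pins all Harder–Narasimhan phases to `a`; this
detects semistable kernels below. -/
lemma P_of_noHom {a : ℝ} (h1 : ∀ ψ D, ψ < a → σ.P ψ D → NoHom E D)
    (h2 : ∀ ψ D, a < ψ → σ.P ψ D → NoHom D E) : σ.P a E := by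
  obtain ⟨l, hl⟩ := σ.exists_HN E
  exact P_of_HN hl fun x hx =>
    le_antisymm (HN_ge_of_noHom hl h2 x hx) (HN_le_of_noHom hl h1 x hx)

lemma HN_eq_of_P {a : ℝ} (h : HN σ.P l E) (hE : σ.P a E) : ∀ x ∈ l, x.1 = a := fun x hx =>
  le_antisymm (HN_ge_of_noHom h (fun _ _ hψ hD => noHom hD hE hψ) x hx)
    (HN_le_of_noHom h (fun _ _ hψ hD => noHom hE hD hψ) x hx)

end NumStabilityCondition

end Slicing

end StabCond

/-! ### Orientation, Serre bounds and rigidity for a fixed charge -/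

namespace StabCond

/-- The determinant of a pair of vectors of `ℂ = ℝ²`. -/
def cross (a b : ℂ) : ℝ := a.re * b.im - a.im * b.re

lemma cross_add_right (a b c : ℂ) : cross a (b + c) = cross a b + cross a c := by
  simp [cross]; ring

lemma cross_add_left (a b c : ℂ) : cross (a + b) c = cross a c + cross b c := by
  simp [cross]; ring

lemma cross_smul_right (a b : ℂ) (t : ℝ) : cross a (t • b) = t * cross a b := by
  simp [cross]; ring

lemma cross_smul_left (a b : ℂ) (t : ℝ) : cross (t • a) b = t * cross a b := by
  simp [cross]; ring

lemma cross_zsmul_right (a b : ℂ) (t : ℤ) : cross a (t • b) = t * cross a b := by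
  simp [cross]; ring

lemma cross_self (a : ℂ) : cross a a = 0 := by
  simp [cross]; ring

lemma cross_swap (a b : ℂ) : cross a b = -cross b a := by
  simp [cross]; ring

lemma ne_zero_of_cross {a b : ℂ} (h : cross a b ≠ 0) : a ≠ 0 := by
  rintro rfl
  simp [cross] at h

section SerreBound

variable {K : Type w} [Field K] {C : Type u} [Category.{v} C] [Preadditive C] [HasZeroObject C]
  [HasShift C ℤ] [∀ n : ℤ, (shiftFunctor C n).Additive] [Pretriangulated C]
  [Linear K C] [∀ n : ℤ, (shiftFunctor C n).Linear K] [IsOfFiniteType K C]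

/-- The Serre functor increases the phase of semistable objects by at most two. -/
def SerreBound (S : SerreFunctor K C) (σ : NumStabilityCondition K C) : Prop :=
  ∀ ψ E, σ.P ψ E → ¬ IsZero E → ∃ ψ' ≤ ψ + 2, σ.P ψ' (S.equiv.functor.obj E)

open NumStabilityCondition

variable {S : SerreFunctor K C} {σ τ : NumStabilityCondition K C}

/-- `Hom(E, F[i])` is dual to `Hom(F[i], S E)`, and `S E` has phase at most `φ + 2`. -/
lemma SerreBound.noHom (hσ : SerreBound S σ) {φ ψ : ℝ} {E F : C} (hE : σ.P φ E)
    (hF : σ.P ψ F) {i : ℤ} (h : φ + 2 < ψ + i) : NoHom E (F⟦i⟧) := by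
  by_cases h0 : IsZero E
  · exact .of_isZero_left h0
  · obtain ⟨ψ', hψ', h'⟩ := hσ φ E hE h0
    exact S.noHom_of (NumStabilityCondition.noHom (σ.P_shift i hF) h' (by linarith))

lemma SerreBound.le_and_le (hσ : SerreBound S σ) {φ ψ : ℝ} {E F : C} (hE : σ.P φ E)
    (hF : σ.P ψ F) {i : ℤ} (h : ¬ NoHom E (F⟦i⟧)) : φ ≤ ψ + i ∧ ψ + i ≤ φ + 2 := by
  constructor
  · by_contra! h'
    exact h (noHom_shift hE hF h')
  · by_contra! h'
    exact h (hσ.noHom hE hF h')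

lemma SerreBound.eulerObj_eq (hσ : SerreBound S σ) {φ : ℝ} {E F : C} (hE : σ.P φ E)
    (hF : σ.P φ F) : eulerObj K E F = homDim K E F 0 - homDim K E F 1 + homDim K E F 2 := by
  refine eulerObj_eq_three K fun i hi => homDim_eq_zero K ?_
  by_contra h
  obtain ⟨h1, h2⟩ := hσ.le_and_le hE hF h
  have h1' : (0 : ℝ) ≤ i := by linarith
  have h2' : (i : ℝ) ≤ 2 := by linarith
  norm_cast at h1' h2'
  omega

variable {ℓ : ℤ} (hχ : ∀ v : NumK0 K C, v ≠ 0 → numEulerForm K C v v ≤ ℓ)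

include hχ in
-- In `χ(E, E) = hom⁰ - hom¹ + hom² ≤ ℓ` the identity contributes at least 1 to `hom⁰`.
lemma SerreBound.one_sub_le (hσ : SerreBound S σ) {φ : ℝ} {E : C} (hE : σ.P φ E)
    (h0 : ¬ IsZero E) : 1 - ℓ ≤ homDim K E E 1 := by
  have h1 := hχ _ (of_ne_zero hE h0)
  rw [numEulerForm_of, hσ.eulerObj_eq hE hE] at h1
  have := one_le_homDim_zero K h0
  omega

lemma SerreBound.sum_le (hσ : SerreBound S σ) {l : List (ℝ × C)} {E : C} (h : HN σ.P l E) :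
    (l.map fun x => homDim K x.2 x.2 1).sum ≤ homDim K E E 1 := by
  induction h with
  | zero => simp
  | cons T hT h1 _ h3 h4 ih =>
    -- The factors of `T.obj₁` have phases above that of `T.obj₃`, which gives the first vanishing.
    -- After a shift by 2 they exceed it by more than 2, which gives the second through the Serre
    -- bound.
    have := homDim_one_add_le K T hT
      (h1.noHom_left fun x hx => NumStabilityCondition.noHom (h1.mem x hx).1 h3 (h4 x hx))
      (h1.noHom_right_shift 2 fun x hx => hσ.noHom h3 (h1.mem x hx).1
        (by push_cast; linarith [h4 x hx]))
    simp only [List.map_cons, List.sum_cons]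
    omega

include hχ in
-- Two factors would already cost `hom¹ ≥ 2(1 - ℓ)`, which is the upper bound allowed for `Q`.
lemma SerreBound.exists_P (hσ : SerreBound S σ) {Q : C}
    (h1 : -ℓ + 1 ≤ (homDim K Q Q 1 : ℤ)) (h2 : (homDim K Q Q 1 : ℤ) < -2 * ℓ + 2) :
    ¬ IsZero Q ∧ ∃ φ, σ.P φ Q := by
  have h0 : ¬ IsZero Q := fun h0 => by
    have := homDim_eq_zero K (i := 1) (NoHom.of_isZero_left (F := Q⟦(1 : ℤ)⟧) h0)
    omega
  refine ⟨h0, ?_⟩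
  obtain ⟨l, hl⟩ := σ.exists_HN Q
  have hsum := hσ.sum_le hl
  match l with
  | [] => exact absurd hl.isZero h0
  | [x] => exact ⟨x.1, P_of_HN hl (by simp)⟩
  | x :: y :: l =>
    have hx := hσ.one_sub_le hχ (hl.mem x (by simp)).1 (hl.mem x (by simp)).2
    have hy := hσ.one_sub_le hχ (hl.mem y (by simp)).1 (hl.mem y (by simp)).2
    simp only [List.map_cons, List.sum_cons] at hsum
    omega

/-! ### Comparison of stability conditions with the same central charge -/

lemma indep_of_cross {v w : NumK0 K C} (h : cross (σ.Z v) (σ.Z w) ≠ 0) : Indep v w := by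
  intro a b hab
  have hZ : a • σ.Z v + b • σ.Z w = 0 := by
    rw [← map_zsmul, ← map_zsmul, ← map_add, hab, map_zero]
  have h1 := congrArg (cross (σ.Z v)) hZ
  have h2 := congrArg (cross (σ.Z w)) hZ
  have h3 : ∀ z, cross z 0 = 0 := fun z => by simp [cross]
  rw [cross_add_right, cross_zsmul_right, cross_zsmul_right, cross_self, h3] at h1 h2
  rw [cross_swap (σ.Z w)] at h2
  simp only [mul_zero, zero_add, add_zero, mul_neg, neg_eq_zero, mul_eq_zero, h, or_false,
    Int.cast_eq_zero] at h1 h2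
  exact ⟨h2, h1⟩

include hχ in
-- Equal charges make `a - b` a positive even integer. If some `Hom(Q, E[i]) ≠ 0`, both phases of
-- `E[i]` lie in `[p, p + 2]`, so they are exactly `p + 2` and `p`. Then `χ(Q, E[i]) > 0`, whereas
-- `[E[i]]` is a positive multiple of `[Q]` and `χ(Q, Q) < 0`.
lemma SerreBound.eulerObj_eq_zero_of_lt (hσ : SerreBound S σ) (hτ : SerreBound S τ) (hℓ : ℓ < 0)
    (hrank : Module.finrank ℤ (NumK0 K C) = 2) (hZ : σ.Z = τ.Z) {Q Q' : C} {p : ℝ}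
    (hσQ : σ.P p Q) (hτQ : τ.P p Q)
    (hQ : cross (σ.Z (NumK0.of K Q)) (σ.Z (NumK0.of K Q')) ≠ 0) {E : C} {a b : ℝ}
    (ha : σ.P a E) (hb : τ.P b E) (h0 : ¬ IsZero E) (hab : b < a) : eulerObj K Q E = 0 := by
  by_contra hE
  obtain ⟨i, hi⟩ := exists_not_noHom_of_eulerObj_ne_zero K hE
  have hQ0 : ¬ IsZero Q := fun h => hi (.of_isZero_left h)
  obtain ⟨m₁, hm₁, e₁⟩ := σ.charge _ _ ha h0
  obtain ⟨m₂, hm₂, e₂⟩ := τ.charge _ _ hb h0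
  obtain ⟨n, hn⟩ := phase_eq_of_ray hm₁ hm₂ (by rw [← e₁, ← e₂, hZ])
  have hn1 : (1 : ℝ) ≤ n := by
    have : (0 : ℝ) < n := by linarith
    norm_cast at this ⊢
  have b1 := hσ.le_and_le hσQ ha hi
  have b2 := hτ.le_and_le hτQ hb hi
  have ha' : a + i = p + 2 := by linarith
  have hb' : b + i = p := by linarith
  have haF := σ.P_shift i ha
  have hbF := τ.P_shift i hb
  rw [ha'] at haF
  rw [hb'] at hbF
  have hF0 : ¬ IsZero (E⟦i⟧) := fun h => hi (.of_isZero_right h)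
  -- In degree `j`, the phase `p + 2` for `σ` forces `j ≤ 0` and the phase `p` for `τ` forces `j ≥
  -- 0`; only `hom⁰` survives.
  have hpos : 0 < eulerObj K Q (E⟦i⟧) := by
    rw [eulerObj_eq_single K 0]
    · have : 0 < homDim K Q (E⟦i⟧) 0 := by
        rw [homDim_shift_right, add_zero]
        exact homDim_pos K hi
      simpa using this
    · intro j hj
      refine homDim_eq_zero K ?_
      by_contra h
      have c1 := hσ.le_and_le hσQ haF h
      have c2 := hτ.le_and_le hτQ hbF h
      have d1 : (0 : ℝ) ≤ j := by linarith
      have d2 : (j : ℝ) ≤ 0 := by linarith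
      norm_cast at d1 d2
      omega
  obtain ⟨m, hm, e⟩ := τ.charge _ _ hbF hF0
  obtain ⟨m', hm', e'⟩ := τ.charge _ _ hτQ hQ0
  rw [← hZ] at e e'
  have ht : 0 < m / m' := div_pos hm hm'
  have hF : σ.Z (NumK0.of K (E⟦i⟧)) = (m / m') • σ.Z (NumK0.of K Q) := by
    rw [e, e', Complex.real_smul, ← mul_assoc, ← Complex.ofReal_mul, div_mul_cancel₀ _ hm'.ne']
  obtain ⟨n, a', b', hn, hrel⟩ := exists_relation hrank (indep_of_cross hQ) (NumK0.of K (E⟦i⟧))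
  have hZrel := congrArg σ.Z hrel
  rw [map_zsmul, map_add, map_zsmul, map_zsmul, hF] at hZrel
  -- `Z(E[i])` is parallel to `Z(Q)`, so the class of `Q'` does not enter the relation.
  have hb0 : b' = 0 := by
    have := congrArg (cross (σ.Z (NumK0.of K Q))) hZrel
    rw [cross_add_right, cross_zsmul_right, cross_smul_right, cross_zsmul_right,
      cross_zsmul_right, cross_self] at this
    simp only [mul_zero, zero_add, zero_eq_mul, hQ, or_false, Int.cast_eq_zero] at this
    exact this
  have ha0 : (n : ℝ) * (m / m') = a' := by
    have hne := ne_zero_of_cross hQ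
    rw [hb0, zero_smul, add_zero, ← Int.cast_smul_eq_zsmul ℝ, ← Int.cast_smul_eq_zsmul ℝ a',
      smul_smul] at hZrel
    exact smul_left_injective ℝ hne hZrel
  have hχrel := congrArg (numEulerForm K C (NumK0.of K Q)) hrel
  rw [hb0, zero_zsmul, add_zero, map_zsmul, map_zsmul, numEulerForm_of, numEulerForm_of,
    smul_eq_mul, smul_eq_mul] at hχrel
  have hneg : eulerObj K Q Q < 0 := by
    have := hχ _ (of_ne_zero hτQ hQ0)
    rw [numEulerForm_of] at this
    omega
  have hχrel' : (n : ℝ) * eulerObj K Q (E⟦i⟧) = n * ((m / m') * eulerObj K Q Q) := by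
    rw [← mul_assoc, ha0]
    exact_mod_cast hχrel
  have h3 := mul_left_cancel₀ (by exact_mod_cast hn) hχrel'
  have h4 : (0 : ℝ) < eulerObj K Q (E⟦i⟧) := by exact_mod_cast hpos
  have h5 : (eulerObj K Q Q : ℝ) < 0 := by exact_mod_cast hneg
  nlinarith

/-- Two objects, semistable of the same phase with respect to both stability conditions and with
linearly independent central charges. -/
structure TestPair (σ τ : NumStabilityCondition K C) (Q Q' : C) (p p' : ℝ) : Prop where
  left₁ : σ.P p Q
  left₂ : σ.P p' Q'
  right₁ : τ.P p Q
  right₂ : τ.P p' Q'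
  cross_ne : cross (σ.Z (NumK0.of K Q)) (σ.Z (NumK0.of K Q')) ≠ 0

variable {Q Q' : C} {p p' : ℝ}

lemma TestPair.symm (h : TestPair σ τ Q Q' p p') (hZ : σ.Z = τ.Z) : TestPair τ σ Q Q' p p' :=
  ⟨h.3, h.4, h.1, h.2, hZ ▸ h.5⟩

include hχ in
-- Otherwise `[E]` would be orthogonal to two independent classes, hence zero, although its charge
-- is not.
lemma TestPair.phase_le (h : TestPair σ τ Q Q' p p') (hσ : SerreBound S σ) (hτ : SerreBound S τ)
    (hℓ : ℓ < 0) (hrank : Module.finrank ℤ (NumK0 K C) = 2) (hZ : σ.Z = τ.Z) {E : C} {a b : ℝ}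
    (ha : σ.P a E) (hb : τ.P b E) (h0 : ¬ IsZero E) : a ≤ b := by
  by_contra! hab
  have h1 := hσ.eulerObj_eq_zero_of_lt hχ hτ hℓ hrank hZ h.left₁ h.right₁ h.cross_ne ha hb h0 hab
  have h2 := hσ.eulerObj_eq_zero_of_lt hχ hτ hℓ hrank hZ h.left₂ h.right₂ (Q' := Q)
    (by rw [cross_swap]; exact neg_ne_zero.2 h.cross_ne) ha hb h0 hab
  refine of_ne_zero ha h0 ((indep_of_cross h.cross_ne).eq_zero_of_orthogonal
    (B := numEulerForm K C) (fun v hv => (hχ v hv).trans_lt hℓ) hrank ?_ ?_)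
  · rwa [numEulerForm_of]
  · rwa [numEulerForm_of]

lemma lt_sum_of_mem {α : Type*} (f : α → ℕ) {l : List α} (hf : ∀ x ∈ l, 1 ≤ f x) {x : α}
    (hx : x ∈ l) (hl : 2 ≤ l.length) : f x < (l.map f).sum := by
  obtain ⟨s, t, rfl⟩ := List.append_of_mem hx
  have h : ∀ s : List α, (∀ y ∈ s, 1 ≤ f y) → s.length ≤ (s.map f).sum := fun s hs => by
    simpa using List.length_le_sum_of_one_le (s.map f) (by simpa using hs)
  have h1 := h s fun y hy => hf y (by simp [hy])
  have h2 := h t fun y hy => hf y (by simp [hy])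
  simp only [List.length_append, List.length_cons, List.map_append, List.map_cons,
    List.sum_append, List.sum_cons] at hl ⊢
  omega

include hχ in
-- Each factor of a nontrivial `τ`-filtration has smaller `hom¹`, hence is also `σ`-semistable of
-- the same phase. So the `τ`-filtration is the `σ`-filtration of an object that is already
-- `σ`-semistable, and all its phases equal `φ`.
lemma TestPair.P_of_P (h : TestPair σ τ Q Q' p p') (hσ : SerreBound S σ) (hτ : SerreBound S τ)
    (hℓ : ℓ < 0) (hrank : Module.finrank ℤ (NumK0 K C) = 2) (hZ : σ.Z = τ.Z) {E : C}
    (ih : ∀ F : C, homDim K F F 1 < homDim K E E 1 → ∀ φ, τ.P φ F → σ.P φ F)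
    {φ : ℝ} (hE : σ.P φ E) : τ.P φ E := by
  obtain ⟨l, hl⟩ := τ.exists_HN E
  have hsum := hτ.sum_le hl
  rcases lt_or_ge l.length 2 with hlen | hlen
  · match l with
    | [] => exact τ.mem_of_isZero _ _ hl.isZero
    | [x] =>
      have hx : τ.P x.1 E := P_of_HN hl (by simp)
      by_cases h0 : IsZero E
      · exact τ.mem_of_isZero _ _ h0
      · rwa [(h.phase_le hχ hσ hτ hℓ hrank hZ hE hx h0).antisymm
          ((h.symm hZ).phase_le hχ hτ hσ hℓ hrank hZ.symm hx hE h0)]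
    | x :: y :: l =>
      simp at hlen
  · refine P_of_HN hl (HN_eq_of_P (hl.mono fun x hx => ?_) hE)
    refine ih _ ((lt_sum_of_mem (fun x => homDim K x.2 x.2 1) (fun y hy => ?_) hx hlen).trans_le
      hsum) _ (hl.mem x hx).1
    have := hτ.one_sub_le hχ (hl.mem y hy).1 (hl.mem y hy).2
    omega

include hχ in
lemma TestPair.P_iff (h : TestPair σ τ Q Q' p p') (hσ : SerreBound S σ) (hτ : SerreBound S τ)
    (hℓ : ℓ < 0) (hrank : Module.finrank ℤ (NumK0 K C) = 2) (hZ : σ.Z = τ.Z) (n : ℕ) :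
    ∀ E : C, homDim K E E 1 = n → ∀ φ, σ.P φ E ↔ τ.P φ E := by
  induction n using Nat.strong_induction_on with
  | _ n ih =>
    rintro E rfl φ
    exact ⟨h.P_of_P hχ hσ hτ hℓ hrank hZ fun F hF φ => (ih _ hF F rfl φ).2,
      (h.symm hZ).P_of_P hχ hτ hσ hℓ hrank hZ.symm fun F hF φ => (ih _ hF F rfl φ).1⟩

include hχ in
lemma TestPair.eq (h : TestPair σ τ Q Q' p p') (hσ : SerreBound S σ) (hτ : SerreBound S τ)
    (hℓ : ℓ < 0) (hrank : Module.finrank ℤ (NumK0 K C) = 2) (hZ : σ.Z = τ.Z) : σ = τ := by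
  have hP : σ.P = τ.P := by
    funext φ
    ext E
    exact h.P_iff hχ hσ hτ hℓ hrank hZ _ E rfl φ
  cases σ
  cases τ
  simp only at hP hZ
  subst hP hZ
  rfl

end SerreBound

end StabCond

namespace StabCond

/-! ### Lifting linear maps to the universal cover -/

lemma phaseVec_re (a : ℝ) : (phaseVec a).re = Real.cos (Real.pi * a) := by
  rw [phaseVec, ← Complex.ofReal_mul, Complex.exp_ofReal_mul_I_re]

lemma phaseVec_im (a : ℝ) : (phaseVec a).im = Real.sin (Real.pi * a) := by
  rw [phaseVec, ← Complex.ofReal_mul, Complex.exp_ofReal_mul_I_im]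

lemma cross_phaseVec (a b : ℝ) :
    cross (phaseVec a) (phaseVec b) = Real.sin (Real.pi * (b - a)) := by
  rw [cross, phaseVec_re, phaseVec_re, phaseVec_im, phaseVec_im, mul_sub, Real.sin_sub]
  ring

lemma cross_phaseVec_of_eq {z w : ℂ} {m n a b : ℝ} (hz : z = m * phaseVec a)
    (hw : w = n * phaseVec b) : cross z w = m * n * Real.sin (Real.pi * (b - a)) := by
  rw [hz, hw, ← Complex.real_smul, ← Complex.real_smul, cross_smul_right, cross_smul_left,
    cross_phaseVec]
  ring

lemma phaseVec_add (a b : ℝ) : phaseVec (a + b) = phaseVec a * phaseVec b := by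
  rw [phaseVec, phaseVec, phaseVec, ← Complex.exp_add]
  push_cast
  ring_nf

lemma phaseVec_zero : phaseVec 0 = 1 := by simp [phaseVec]

lemma phaseVec_intCast (n : ℤ) : phaseVec n = ((Real.cos (Real.pi * n) : ℝ) : ℂ) := by
  apply Complex.ext
  · rw [phaseVec_re, Complex.ofReal_re]
  · rw [phaseVec_im, Complex.ofReal_im, mul_comm, Real.sin_int_mul_pi]

lemma phaseVec_one : phaseVec 1 = -1 := by
  simpa using phaseVec_intCast 1

lemma cross_mul_right (a b u : ℂ) : cross (a * u) (b * u) = Complex.normSq u * cross a b := by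
  simp only [cross, Complex.mul_re, Complex.mul_im, Complex.normSq_apply]
  ring

lemma cross_map (M : ℂ →ₗ[ℝ] ℂ) (a b : ℂ) :
    cross (M a) (M b) = LinearMap.det M * cross a b := by
  have h : ∀ z : ℂ, M z = z.re • M 1 + z.im • M Complex.I := fun z => by
    rw [← map_smul, ← map_smul, ← map_add]
    congr 1
    simp [Complex.re_add_im]
  have hdet : LinearMap.det M = cross (M 1) (M Complex.I) := by
    rw [← LinearMap.det_toMatrix Complex.basisOneI, Matrix.det_fin_two]
    simp [LinearMap.toMatrix_apply, cross]
    ring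
  rw [hdet, h a, h b]
  simp only [cross, Complex.add_re, Complex.add_im, Complex.smul_re, Complex.smul_im, smul_eq_mul]
  ring

/-- Cramer's rule. -/
lemma eq_of_cross {z w : ℂ} (h : cross z w ≠ 0) (x : ℂ) :
    x = (cross x w / cross z w) • z + (cross z x / cross z w) • w := by
  apply Complex.ext
  · simp only [Complex.add_re, Complex.smul_re, smul_eq_mul]
    field_simp
    simp only [cross]
    ring
  · simp only [Complex.add_im, Complex.smul_im, smul_eq_mul]
    field_simp
    simp only [cross]
    ring

/-- The `ℝ`-linear map of `ℂ` taking the basis `z`, `w` to `z'`, `w'`. -/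
noncomputable def basisChange (z w z' w' : ℂ) : ℂ →ₗ[ℝ] ℂ where
  toFun x := (cross x w / cross z w) • z' + (cross z x / cross z w) • w'
  map_add' x y := by
    rw [cross_add_left, cross_add_right, add_div, add_div, add_smul, add_smul]
    abel
  map_smul' c x := by
    rw [cross_smul_left, cross_smul_right, mul_div_assoc, mul_div_assoc, mul_smul, mul_smul,
      smul_add, RingHom.id_apply]

lemma basisChange_left {z w : ℂ} (h : cross z w ≠ 0) (z' w' : ℂ) :
    basisChange z w z' w' z = z' := by
  simp [basisChange, h, cross_self]

lemma basisChange_right {z w : ℂ} (h : cross z w ≠ 0) (z' w' : ℂ) :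
    basisChange z w z' w' w = w' := by
  simp [basisChange, h, cross_self]

lemma exists_linearEquiv {z w z' w' : ℂ} (h : 0 < cross z w * cross z' w') :
    ∃ M : ℂ ≃ₗ[ℝ] ℂ, M z = z' ∧ M w = w' ∧ 0 < LinearMap.det (M : ℂ →ₗ[ℝ] ℂ) := by
  have h1 : cross z w ≠ 0 := fun h0 => by simp [h0] at h
  have h2 : cross z' w' ≠ 0 := fun h0 => by simp [h0] at h
  have hinv : ∀ {z w z' w' : ℂ}, cross z w ≠ 0 → cross z' w' ≠ 0 → ∀ x,
      basisChange z' w' z w (basisChange z w z' w' x) = x := fun {z w z' w'} h1 h2 x => by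
    conv_lhs => rw [eq_of_cross h1 x]
    rw [map_add, map_smul, map_smul, basisChange_left h1, basisChange_right h1, map_add, map_smul,
      map_smul, basisChange_left h2, basisChange_right h2, ← eq_of_cross h1 x]
  let M : ℂ ≃ₗ[ℝ] ℂ := LinearEquiv.ofLinearMap (basisChange z w z' w') (basisChange z' w' z w)
    (LinearMap.ext fun x => hinv h2 h1 x) (LinearMap.ext fun x => hinv h1 h2 x)
  refine ⟨M, basisChange_left h1 _ _, basisChange_right h1 _ _, ?_⟩
  have := cross_map (basisChange z w z' w') z w
  rw [basisChange_left h1, basisChange_right h1] at this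
  rw [this] at h
  -- The determinant is the ratio of the two orientations, hence positive.
  have h' : 0 < LinearMap.det (basisChange z w z' w') * (cross z w * cross z w) := by linarith
  exact pos_of_mul_pos_left h' (mul_self_nonneg _)

section Lift

variable (M : ℂ ≃ₗ[ℝ] ℂ) (a b : ℝ)

/-- The phase, relative to `b`, of the image under `M` of the ray of phase `a + t`. -/
noncomputable def relPhase (t : ℝ) : ℝ :=
  (M (phaseVec (a + t)) * phaseVec (-b)).arg / Real.pi

variable {a b}

/-- Rotating by `-b` before taking the principal argument puts the branch cut opposite the image ray
of phase `b`, so no jump occurs for `0 ≤ t < 1`. -/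
lemma map_phaseVec (t : ℝ) :
    M (phaseVec (a + t)) = ‖M (phaseVec (a + t))‖ * phaseVec (b + relPhase M a b t) := by
  have hpi : (Real.pi : ℂ) ≠ 0 := by exact_mod_cast Real.pi_ne_zero
  have h : M (phaseVec (a + t)) * phaseVec (-b) =
      ‖M (phaseVec (a + t))‖ * phaseVec (relPhase M a b t) := by
    conv_lhs => rw [← Complex.norm_mul_exp_arg_mul_I (M (phaseVec (a + t)) * phaseVec (-b))]
    rw [norm_mul, norm_phaseVec, mul_one, relPhase, phaseVec.eq_1 (_ / _), Complex.ofReal_div,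
      mul_div_cancel₀ _ hpi]
  have hb : phaseVec (-b) * phaseVec b = 1 := by
    rw [← phaseVec_add, neg_add_cancel, phaseVec_zero]
  rw [phaseVec_add b, mul_comm (phaseVec b), ← mul_assoc, ← h, mul_assoc, hb, mul_one]

variable {M} (hM : 0 < LinearMap.det (M : ℂ →ₗ[ℝ] ℂ)) {c : ℝ} (hc : 0 < c)
  (h : M (phaseVec a) = c * phaseVec b)

include hc h in
lemma relPhase_zero : relPhase M a b 0 = 0 := by
  have hb : phaseVec b * phaseVec (-b) = 1 := by
    rw [← phaseVec_add, add_neg_cancel, phaseVec_zero]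
  rw [relPhase, add_zero, h, mul_assoc, hb, mul_one, Complex.arg_ofReal_of_nonneg hc.le, zero_div]

include hM hc h in
lemma relPhase_mem {t : ℝ} (h0 : 0 ≤ t) (h1 : t < 1) :
    0 ≤ relPhase M a b t ∧ relPhase M a b t < 1 := by
  rcases h0.eq_or_lt with rfl | h0
  · rw [relPhase_zero hc h]
    norm_num
  have him : 0 < (M (phaseVec (a + t)) * phaseVec (-b)).im := by
    have e1 : cross (M (phaseVec a)) (M (phaseVec (a + t))) =
        LinearMap.det (M : ℂ →ₗ[ℝ] ℂ) * Real.sin (Real.pi * t) := by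
      have := cross_map (M : ℂ →ₗ[ℝ] ℂ) (phaseVec a) (phaseVec (a + t))
      rw [cross_phaseVec, add_sub_cancel_left] at this
      exact this
    have e2 := cross_mul_right (M (phaseVec a)) (M (phaseVec (a + t))) (phaseVec (-b))
    have hb : phaseVec b * phaseVec (-b) = 1 := by
      rw [← phaseVec_add, add_neg_cancel, phaseVec_zero]
    rw [Complex.normSq_eq_norm_sq, norm_phaseVec, e1, h, mul_assoc, hb] at e2
    simp only [cross, mul_one, Complex.ofReal_re, Complex.ofReal_im, zero_mul, sub_zero, one_pow,
      one_mul] at e2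
    have hs : 0 < Real.sin (Real.pi * t) :=
      Real.sin_pos_of_pos_of_lt_pi (by positivity) (by nlinarith [Real.pi_pos])
    have : 0 < c * (M (phaseVec (a + t)) * phaseVec (-b)).im := by
      rw [e2]; positivity
    exact pos_of_mul_pos_right this hc.le
  constructor
  · exact div_nonneg (Complex.arg_nonneg_iff.2 him.le) Real.pi_pos.le
  · rw [relPhase, div_lt_one Real.pi_pos]
    exact Complex.arg_lt_pi_iff.2 (Or.inr him.ne')

include hM hc h in
-- `M` preserves the sign of the sine of the angle between two rays, and both relative phases lie in
-- `[0, 1)`, where this sign determines the order.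
lemma relPhase_lt {s t : ℝ} (h0 : 0 ≤ s) (hst : s < t) (h1 : t < 1) :
    relPhase M a b s < relPhase M a b t := by
  by_contra! hle
  have hs := relPhase_mem hM hc h h0 (hst.trans h1)
  have ht := relPhase_mem hM hc h (h0.trans hst.le) h1
  have e1 : cross (M (phaseVec (a + s))) (M (phaseVec (a + t))) =
      LinearMap.det (M : ℂ →ₗ[ℝ] ℂ) * Real.sin (Real.pi * (t - s)) := by
    have := cross_map (M : ℂ →ₗ[ℝ] ℂ) (phaseVec (a + s)) (phaseVec (a + t))
    rw [cross_phaseVec, add_sub_add_left_eq_sub] at this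
    exact this
  have e2 := cross_phaseVec_of_eq (map_phaseVec M (a := a) (b := b) s)
    (map_phaseVec M (a := a) (b := b) t)
  rw [add_sub_add_left_eq_sub] at e2
  have p1 : 0 < Real.sin (Real.pi * (t - s)) :=
    Real.sin_pos_of_pos_of_lt_pi (mul_pos Real.pi_pos (by linarith))
      (by nlinarith [Real.pi_pos])
  have p2 : Real.sin (Real.pi * (relPhase M a b t - relPhase M a b s)) ≤ 0 :=
    Real.sin_nonpos_of_nonpos_of_neg_pi_le
      (mul_nonpos_of_nonneg_of_nonpos Real.pi_pos.le (by linarith)) (by nlinarith [Real.pi_pos])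
  have p3 : 0 < LinearMap.det (M : ℂ →ₗ[ℝ] ℂ) * Real.sin (Real.pi * (t - s)) := mul_pos hM p1
  rw [← e1, e2] at p3
  exact absurd p3 (not_lt.2 (mul_nonpos_of_nonneg_of_nonpos (by positivity) p2))

include hM hc h in
/-- An orientation preserving linear map lifts to the universal cover, and the lift may be
prescribed at one phase. -/
lemma exists_GL2PosCover : ∃ γ : GL2PosCover, γ.M = M ∧ γ.g a = b := by
  -- The lift is built on `[a, a + 1)` from the principal argument and extended by `g(x + 1) = g(x)
  -- + 1`, matching `M(-z) = -M z`.
  refine ⟨{ g := fun x => b + ⌊x - a⌋ + relPhase M a b (Int.fract (x - a))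
            M := M
            strictMono := fun x y hxy => ?_
            map_add_one := fun x => ?_
            det_pos := hM
            compat := fun x => ?_ }, rfl, ?_⟩
  · have hx := relPhase_mem hM hc h (Int.fract_nonneg (x - a)) (Int.fract_lt_one (x - a))
    have hy := relPhase_mem hM hc h (Int.fract_nonneg (y - a)) (Int.fract_lt_one (y - a))
    have hxy' : x - a < y - a := by linarith
    rcases (Int.floor_le_floor hxy'.le).eq_or_lt with heq | hlt
    · have : Int.fract (x - a) < Int.fract (y - a) := by
        rw [Int.fract, Int.fract, heq]
        linarith
      have := relPhase_lt hM hc h (Int.fract_nonneg _) this (Int.fract_lt_one _)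
      simp only [heq]
      linarith
    · have : ((⌊x - a⌋ : ℤ) : ℝ) + 1 ≤ (⌊y - a⌋ : ℤ) := by exact_mod_cast hlt
      simp only
      linarith
  · have : x + 1 - a = x - a + 1 := by ring
    simp only [this, Int.floor_add_one, Int.fract_add_one]
    push_cast
    ring
  · set n := ⌊x - a⌋
    set t := Int.fract (x - a)
    have hx : x = a + t + n := by
      have := Int.fract_add_floor (x - a)
      simp only [t, n]
      linarith
    refine ⟨‖M (phaseVec (a + t))‖, norm_pos_iff.2 ?_, ?_⟩
    · simpa using phaseVec_ne_zero (a + t)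
    · rw [hx, phaseVec_add (a + t), phaseVec_intCast, mul_comm, ← Complex.real_smul, map_smul,
        map_phaseVec M (b := b), Complex.real_smul, ← phaseVec_intCast,
        add_right_comm b, phaseVec_add _ (n : ℝ), norm_mul, norm_phaseVec, Complex.norm_real,
        norm_norm]
      push_cast
      ring
  · simp [relPhase_zero hc h]

end Lift

end StabCond

/-! ### Displacement of phases along orbits of the universal cover -/

namespace StabCond

namespace GL2PosCover

variable (γ : GL2PosCover)

lemma iterate_add_int (j : ℕ) (φ : ℝ) (n : ℤ) : γ.g^[j] (φ + n) = γ.g^[j] φ + n := by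
  induction j with
  | zero => rfl
  | succ j ih => rw [Function.iterate_succ_apply', ih, γ.map_add_int, Function.iterate_succ_apply']

variable {γ} {r : ℕ} {k : ℤ} {p : ℝ}

lemma lt_map (hk : 0 < k) (h : γ.g^[r] p = p + k) : p < γ.g p := by
  by_contra! hp
  have : ∀ j : ℕ, γ.g^[j] p ≤ p := by
    intro j
    induction j with
    | zero => exact le_rfl
    | succ j ih =>
      rw [Function.iterate_succ_apply']
      exact (γ.strictMono.monotone ih).trans hp
  have h1 := this r
  rw [h] at h1
  have : (0 : ℝ) < k := by exact_mod_cast hk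
  linarith

lemma le_iterate (m : ℤ) (h : p + m ≤ γ.g p) (j : ℕ) : p + j * m ≤ γ.g^[j] p := by
  induction j with
  | zero => simp
  | succ j ih =>
    rw [Function.iterate_succ_apply']
    have h1 := γ.strictMono.monotone ih
    have h2 := γ.map_add_int p (j * m)
    push_cast at h2 ⊢
    rw [h2] at h1
    linarith

lemma map_lt (hk : k < 2 * r) (h : γ.g^[r] p = p + k) : γ.g p < p + 2 := by
  by_contra! hp
  have h1 := le_iterate 2 (by exact_mod_cast hp) r
  rw [h] at h1
  have : (k : ℝ) < 2 * r := by exact_mod_cast hk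
  push_cast at h1
  linarith

/-- `γ.g` commutes with translation by 2, so a displacement other than 2 at `p` would accumulate in
the same direction at the second step. -/
lemma map_eq_add_two (h : γ.g (γ.g p) = p + 4) : γ.g p = p + 2 := by
  have h2 : γ.g (p + 2) = γ.g p + 2 := by exact_mod_cast γ.map_add_int p 2
  rcases lt_trichotomy (γ.g p) (p + 2) with hlt | heq | hgt
  · have := γ.strictMono hlt
    linarith
  · exact heq
  · have := γ.strictMono hgt
    linarith

/-- The orientation of a phase and its image does not change along the orbit. -/
lemma sin_map_pos_iff (p : ℝ) : 0 < Real.sin (Real.pi * (γ.g (γ.g p) - γ.g p)) ↔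
    0 < Real.sin (Real.pi * (γ.g p - p)) := by
  obtain ⟨c, hc, h⟩ := γ.compat p
  obtain ⟨d, hd, h'⟩ := γ.compat (γ.g p)
  have h1 : cross (γ.M (phaseVec p)) (γ.M (phaseVec (γ.g p))) =
      LinearMap.det (γ.M : ℂ →ₗ[ℝ] ℂ) * cross (phaseVec p) (phaseVec (γ.g p)) :=
    cross_map (γ.M : ℂ →ₗ[ℝ] ℂ) _ _
  rw [cross_phaseVec_of_eq h h', cross_phaseVec] at h1
  have hcd := mul_pos hc hd
  have hdet := γ.det_pos
  rw [← mul_pos_iff_of_pos_left hcd, h1, mul_pos_iff_of_pos_left hdet]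

lemma sin_pos_iff {x : ℝ} (h0 : 0 < x) (h2 : x < 2) : 0 < Real.sin (Real.pi * x) ↔ x < 1 := by
  constructor
  · intro h
    by_contra! h1
    have : 0 ≤ Real.sin (Real.pi * x - Real.pi) :=
      Real.sin_nonneg_of_nonneg_of_le_pi (by nlinarith [Real.pi_pos]) (by nlinarith [Real.pi_pos])
    rw [Real.sin_sub_pi] at this
    linarith
  · intro h
    exact Real.sin_pos_of_pos_of_lt_pi (mul_pos Real.pi_pos h0) (by nlinarith [Real.pi_pos])

lemma map_lt_add_one_iff_orbit (hk : 0 < k) (hk' : k < 2 * r) (h : γ.g^[r] p = p + k) (j : ℕ) :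
    γ.g^[j + 1] p < γ.g^[j] p + 1 ↔ γ.g p < p + 1 := by
  have hj : ∀ j, γ.g^[r] (γ.g^[j] p) = γ.g^[j] p + k := fun j => by
    rw [← Function.iterate_add_apply, add_comm, Function.iterate_add_apply, h, γ.iterate_add_int]
  have hs : ∀ j, 0 < Real.sin (Real.pi * (γ.g (γ.g^[j] p) - γ.g^[j] p)) ↔
      γ.g (γ.g^[j] p) < γ.g^[j] p + 1 := fun j => by
    have h1 := lt_map hk (hj j)
    have h2 := map_lt hk' (hj j)
    rw [sin_pos_iff (by linarith) (by linarith), sub_lt_iff_lt_add']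
  rw [Function.iterate_succ_apply']
  induction j with
  | zero => rfl
  | succ j ih =>
    refine ((hs _).symm.trans ?_).trans ((hs j).trans ih)
    rw [Function.iterate_succ_apply', sin_map_pos_iff]

/-- Whether the displacement is below 1 is constant along the orbit, and `r` steps add up to `k`.
The side on which the image ray lies is thus decided by `r` and `k` alone, whatever the stability
condition. -/
lemma map_lt_add_one_iff (hr : 0 < r) (hk : 0 < k) (hk' : k < 2 * r) (h : γ.g^[r] p = p + k) :
    γ.g p < p + 1 ↔ k < r := by
  constructor
  · intro hp
    have : ∀ j : ℕ, 0 < j → γ.g^[j] p < p + j := by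
      intro j hj
      induction j with
      | zero => omega
      | succ j ih =>
        have h1 := (map_lt_add_one_iff_orbit hk hk' h j).2 hp
        rcases Nat.eq_zero_or_pos j with rfl | hj
        · simpa using hp
        · push_cast
          linarith [ih hj]
    have h1 := this r hr
    rw [h] at h1
    have h2 : (k : ℝ) < r := by linarith
    exact_mod_cast h2
  · intro hkr
    by_contra hp
    have h1 := le_iterate 1 (by push_cast; linarith) r (γ := γ) (p := p)
    rw [h] at h1
    have : (k : ℝ) < r := by exact_mod_cast hkr
    push_cast at h1
    linarith

end GL2PosCover

/-! ### Serre-invariant stability conditions and Serre dimension below two -/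

section SerreInvariant

variable {K : Type w} [Field K] {C : Type u} [Category.{v} C] [Preadditive C] [HasZeroObject C]
  [HasShift C ℤ] [∀ n : ℤ, (shiftFunctor C n).Additive] [Pretriangulated C]
  [Linear K C] [∀ n : ℤ, (shiftFunctor C n).Linear K] [IsOfFiniteType K C]

open NumStabilityCondition

variable {S : SerreFunctor K C} {σ σ₁ σ₂ : NumStabilityCondition K C}

section IsImage

variable {γ : GL2PosCover} (h : IsImage S.equiv σ (σ.act γ))

include h

lemma IsImage.P_obj {φ : ℝ} {E : C} (hE : σ.P φ E) :
    σ.P (γ.g φ) (S.equiv.functor.obj E) := by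
  have : (σ.act γ).P φ (S.equiv.functor.obj E) := by
    rw [h.1 φ]
    exact ObjectProperty.prop_map_obj _ _ hE
  exact this

lemma IsImage.exists_preimage {φ : ℝ} {F : C} (hF : σ.P (γ.g φ) F) :
    ∃ E, σ.P φ E ∧ Nonempty (S.equiv.functor.obj E ≅ F) := by
  have hF' : (σ.act γ).P φ F := hF
  rw [h.1 φ] at hF'
  obtain ⟨E, hE, e⟩ := hF'
  exact ⟨E, hE, e⟩

lemma IsImage.Z_obj (E : C) :
    σ.Z (NumK0.of K (S.equiv.functor.obj E)) = γ.M (σ.Z (NumK0.of K E)) := by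
  have h2 : γ.M.symm (σ.Z (NumK0.of K (S.equiv.functor.obj E))) = σ.Z (NumK0.of K E) :=
    (h.2 (S.equiv.functor.obj E)).trans
      (congrArg σ.Z (NumK0.of_iso K (S.equiv.unitIso.app E).symm))
  rw [← h2, LinearEquiv.apply_symm_apply]

lemma IsImage.P_powNat {φ : ℝ} {E : C} (hE : σ.P φ E) (n : ℕ) :
    σ.P (γ.g^[n] φ) ((S.equiv.powNat n).functor.obj E) := by
  induction n using Nat.strong_induction_on generalizing φ E with
  | _ n ih =>
    match n with
    | 0 => exact hE
    | 1 => exact h.P_obj hE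
    | n + 2 => exact ih (n + 1) (by omega) (h.P_obj hE)

/-- `S^r E ≅ E[k]` is semistable of both phases, and a nonzero object has only one. -/
lemma IsImage.iterate_eq {r : ℕ} {k : ℤ}
    (hS : Nonempty ((S.equiv ^ (r : ℤ)).functor ≅ shiftFunctor C k)) {φ : ℝ} {E : C}
    (hE : σ.P φ E) (h0 : ¬ IsZero E) : γ.g^[r] φ = φ + k := by
  obtain ⟨e⟩ := hS
  have h1 := h.P_powNat hE r
  have h2 : σ.P (γ.g^[r] φ) (E⟦k⟧) := σ.P_of_iso (e.app E) h1
  exact phase_unique h2 (σ.P_shift k hE) (fun h => h0 (.of_full_of_faithful_of_isZero _ _ h))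

end IsImage

lemma SerreBound.act (h : SerreBound S σ) (γ : GL2PosCover) : SerreBound S (σ.act γ) := by
  intro ψ E hE h0
  obtain ⟨ψ', hψ', hP⟩ := h _ E hE h0
  obtain ⟨φ, rfl⟩ := γ.surjective ψ'
  refine ⟨φ, ?_, hP⟩
  have : γ.g (ψ + 2) = γ.g ψ + 2 := by exact_mod_cast γ.map_add_int ψ 2
  rwa [← this, γ.strictMono.le_iff_le] at hψ'

variable {ℓ : ℤ} (hχ : ∀ v : NumK0 K C, v ≠ 0 → numEulerForm K C v v ≤ ℓ) (hℓ : ℓ < 0)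
  (hrank : Module.finrank ℤ (NumK0 K C) = 2)

include hχ hℓ hrank

/-- Two stability conditions bounded with respect to the Serre functor agree up to the action of
the universal cover once two independent classes have semistable representatives with compatible
phases. -/
lemma exists_eq_act (h₁ : SerreBound S σ₁) (h₂ : SerreBound S σ₂) {Q Q' : C}
    (hQ : ¬ IsZero Q) (hQ' : ¬ IsZero Q') {p₁ p₁' p₂ p₂' : ℝ}
    (hp₁ : σ₁.P p₁ Q) (hp₁' : σ₁.P p₁' Q') (hp₂ : σ₂.P p₂ Q) (hp₂' : σ₂.P p₂' Q')
    (b₁ : p₁ < p₁') (c₁ : p₁' < p₁ + 2) (b₂ : p₂ < p₂') (c₂ : p₂' < p₂ + 2)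
    (hcross : 0 < cross (σ₁.Z (NumK0.of K Q)) (σ₁.Z (NumK0.of K Q')) *
      cross (σ₂.Z (NumK0.of K Q)) (σ₂.Z (NumK0.of K Q'))) :
    ∃ γ : GL2PosCover, σ₁ = σ₂.act γ := by
  obtain ⟨M, hM, hM', hdet⟩ := exists_linearEquiv hcross
  obtain ⟨m₁, hm₁, e₁⟩ := σ₁.charge _ _ hp₁ hQ
  obtain ⟨m₂, hm₂, e₂⟩ := σ₂.charge _ _ hp₂ hQ
  have hMp : M (phaseVec p₁) = ((m₂ / m₁ : ℝ) : ℂ) * phaseVec p₂ := by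
    have h1 : phaseVec p₁ = m₁⁻¹ • σ₁.Z (NumK0.of K Q) := by
      rw [e₁, Complex.real_smul, ← mul_assoc, ← Complex.ofReal_mul, inv_mul_cancel₀ hm₁.ne']
      simp
    rw [h1, map_smul, hM, e₂, Complex.real_smul]
    push_cast
    ring
  obtain ⟨γ, hγM, hγ⟩ := exists_GL2PosCover hdet (div_pos hm₂ hm₁) hMp
  refine ⟨γ, ?_⟩
  have hind := indep_of_cross (σ := σ₁) (v := NumK0.of K Q) (w := NumK0.of K Q')
    (fun h0 => by simp [h0] at hcross)
  have hZ : ∀ x, (σ₂.act γ).Z x = M.symm (σ₂.Z x) := fun x => by rw [← hγM]; rfl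
  have hZQ : (σ₂.act γ).Z (NumK0.of K Q) = σ₁.Z (NumK0.of K Q) := by
    rw [hZ, ← hM, LinearEquiv.symm_apply_apply]
  have hZQ' : (σ₂.act γ).Z (NumK0.of K Q') = σ₁.Z (NumK0.of K Q') := by
    rw [hZ, ← hM', LinearEquiv.symm_apply_apply]
  have hZeq : σ₁.Z = (σ₂.act γ).Z := by
    refine AddMonoidHom.ext fun x => ?_
    obtain ⟨n, a, b, hn, hx⟩ := exists_relation hrank hind x
    have : n • σ₁.Z x = n • (σ₂.act γ).Z x := by
      rw [← map_zsmul, ← map_zsmul, hx, map_add, map_add, map_zsmul, map_zsmul, map_zsmul,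
        map_zsmul, hZQ, hZQ']
    exact smul_right_injective ℂ hn this
  obtain ⟨q, hq⟩ := γ.surjective p₂'
  have hqP : (σ₂.act γ).P q Q' := by
    change σ₂.P (γ.g q) Q'
    rwa [hq]
  have hadd : γ.g (p₁ + 2) = γ.g p₁ + 2 := by exact_mod_cast γ.map_add_int p₁ 2
  have hq1 : p₁ < q := by rwa [← γ.strictMono.lt_iff_lt, hq, hγ]
  have hq2 : q < p₁ + 2 := by rwa [← γ.strictMono.lt_iff_lt, hq, hadd, hγ]
  -- Equal charges give the phase of `Q'` only modulo 2; both values lie in `(p₁, p₁ + 2)`, hence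
  -- agree.
  have hqp : p₁' = q := by
    obtain ⟨m, hm, e⟩ := σ₁.charge _ _ hp₁' hQ'
    obtain ⟨m', hm', e'⟩ := (σ₂.act γ).charge _ _ hqP hQ'
    obtain ⟨n, hn⟩ := phase_eq_of_ray hm hm' (by rw [← e, ← e', hZQ'])
    have n1 : (n : ℝ) < 1 := by linarith
    have n2 : (-1 : ℝ) < n := by linarith
    have : n = 0 := by
      norm_cast at n1 n2
      have n2' : (-1 : ℤ) < n := by exact_mod_cast n2
      omega
    simpa [this] using hn
  refine TestPair.eq (Q := Q) (Q' := Q') (p := p₁) (p' := p₁') hχ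
    ⟨hp₁, hp₁', ?_, hqp ▸ hqP, fun h0 => by simp [h0] at hcross⟩ h₁ (h₂.act γ) hℓ hrank hZeq
  change σ₂.P (γ.g p₁) Q
  rwa [hγ]

/-- The charges of a semistable object and of its image under the Serre functor are independent. -/
lemma IsImage.cross_ne_zero {γ : GL2PosCover} (h : IsImage S.equiv σ (σ.act γ))
    {Q : C} {p : ℝ} (hQ : σ.P p Q) (h0 : ¬ IsZero Q) (h1 : p < γ.g p) (h2 : γ.g p < p + 2) :
    cross (σ.Z (NumK0.of K Q)) (σ.Z (NumK0.of K (S.equiv.functor.obj Q))) ≠ 0 := by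
  intro hc
  have hB : ∀ v : NumK0 K C, v ≠ 0 → numEulerForm K C v v < 0 := fun v hv => (hχ v hv).trans_lt hℓ
  set v := NumK0.of K Q with hv
  set w := NumK0.of K (S.equiv.functor.obj Q) with hw
  set u := NumK0.of K (S.equiv.functor.obj (S.equiv.functor.obj Q)) with hu
  have hv0 : v ≠ 0 := of_ne_zero hQ h0
  have hSQ0 : ¬ IsZero (S.equiv.functor.obj Q) := fun h => h0 (S.isZero_iff.1 h)
  obtain ⟨m, hm, e⟩ := σ.charge _ _ hQ h0
  obtain ⟨m', hm', e'⟩ := σ.charge _ _ (h.P_obj hQ) hSQ0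
  -- Dependent charges make the displacement an integer, and 1 is the only one strictly between 0
  -- and 2.
  have hp : γ.g p = p + 1 := by
    rw [cross_phaseVec_of_eq e e'] at hc
    have hs : Real.sin (Real.pi * (γ.g p - p)) = 0 :=
      (mul_eq_zero.1 hc).resolve_left (mul_pos hm hm').ne'
    obtain ⟨n, hn⟩ := Real.sin_eq_zero_iff.1 hs
    have hn' : (n : ℝ) = γ.g p - p := mul_right_cancel₀ Real.pi_ne_zero (by rw [hn]; ring)
    have n1 : (0 : ℝ) < n := by linarith
    have n2 : (n : ℝ) < 2 := by linarith
    norm_cast at n1 n2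
    have : n = 1 := by omega
    rw [this] at hn'
    push_cast at hn'
    linarith
  obtain ⟨c, hc0, hwv⟩ : ∃ c : ℝ, 0 < c ∧ σ.Z w = -c • σ.Z v := by
    refine ⟨m' / m, div_pos hm' hm, ?_⟩
    have hm0 : (m : ℂ) ≠ 0 := by exact_mod_cast hm.ne'
    rw [e, e', hp, phaseVec_add, phaseVec_one, Complex.real_smul]
    push_cast
    field_simp
  have hZv : σ.Z v ≠ 0 := Z_ne_zero hQ h0
  have huv : σ.Z u = (c * c) • σ.Z v := by
    rw [hu, h.Z_obj, ← hw, hwv, map_smul, ← h.Z_obj, ← hw, hwv, smul_smul, neg_mul_neg]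
  set x := eulerObj K Q Q with hx
  set y := eulerObj K (S.equiv.functor.obj Q) Q with hy
  have evv : numEulerForm K C v v = x := numEulerForm_of K _ _
  have evw : numEulerForm K C v w = x := by rw [hv, hw, numEulerForm_of, S.eulerObj_eq]
  have ewv : numEulerForm K C w v = y := numEulerForm_of K _ _
  have eww : numEulerForm K C w w = x := by
    rw [hw, numEulerForm_of, S.eulerObj_eq, S.eulerObj_eq]
  have evu : numEulerForm K C v u = y := by rw [hv, hu, numEulerForm_of, S.eulerObj_eq]
  have ewu : numEulerForm K C w u = x := by
    rw [hw, hu, numEulerForm_of, S.eulerObj_eq, S.eulerObj_eq, S.eulerObj_eq]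
  have hx0 : x < 0 := evv ▸ hB v hv0
  have hvw : v ≠ w := by
    intro hvw
    rw [← hvw] at hwv
    have : (1 + c) • σ.Z v = 0 := by
      rw [add_smul, one_smul]
      nth_rewrite 1 [hwv]
      rw [neg_smul, neg_add_cancel]
    exact (smul_ne_zero (by positivity) hZv) this
  have hind : Indep v w := by
    intro a b hab
    have h3 := congrArg (numEulerForm K C v) hab
    rw [map_add, map_zsmul, map_zsmul, evv, evw, map_zero, smul_eq_mul, smul_eq_mul, ← add_mul]
      at h3
    have h4 : a + b = 0 := (mul_eq_zero.1 h3).resolve_right hx0.ne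
    obtain rfl : b = -a := by omega
    have h5 : a • (v - w) = 0 := by
      rw [← hab, zsmul_sub, neg_zsmul, sub_eq_add_neg]
    have h6 : a = 0 := by
      by_contra ha
      exact hvw (sub_eq_zero.1 (eq_zero_of_zsmul_eq_zero hB ha h5))
    omega
  -- The Cayley–Hamilton type relation for `S` on the rank two lattice, read off from pairings with
  -- `v` and `w`. Applying `Z` gives `x c² + (x + y) c + x = 0`.
  have hd : x • u + x • v - (x + y) • w = 0 := by
    refine hind.eq_zero_of_orthogonal hB hrank ?_ ?_
    · simp only [map_add, map_sub, map_zsmul, evv, evw, evu, smul_eq_mul]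
      ring
    · simp only [map_add, map_sub, map_zsmul, ewv, eww, ewu, smul_eq_mul]
      ring
  have hsum : 3 * x + y < 0 := by
    have h3 := hB (v + w) fun h3 => by
      have := hind 1 1 (by simpa using h3)
      omega
    simp only [map_add, AddMonoidHom.add_apply, evv, evw, ewv, eww] at h3
    omega
  have hZd := congrArg σ.Z hd
  simp only [map_add, map_sub, map_zsmul, map_zero, huv, hwv] at hZd
  have hreal : ((x : ℝ) * (c * c) + x + (x + y) * c) • σ.Z v = 0 := by
    rw [← hZd]
    simp only [← Int.cast_smul_eq_zsmul ℝ, smul_smul, ← add_smul, ← sub_smul]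
    congr 1
    push_cast
    ring
  have h3 := (smul_eq_zero.1 hreal).resolve_right hZv
  have h4 : 3 * (x : ℝ) + y < 0 := by exact_mod_cast hsum
  have h5 : (x : ℝ) < 0 := by exact_mod_cast hx0
  -- The quadratic equals `x (c - 1)² + (3x + y) c`, which is negative because `x < 0`, `c > 0` and
  -- `3x + y = χ(v + w, v + w) < 0`.
  nlinarith [mul_pos hc0 (neg_pos.2 h4), mul_nonneg (neg_pos.2 h5).le (sq_nonneg (c - 1))]

/-- The case of a Serre functor of dimension strictly between zero and two. -/
lemma exists_eq_act_of_dim_lt_two {r : ℕ} {k : ℤ} (hr : 0 < r) (hk : 0 < k) (hk' : k < 2 * r)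
    (hS : Nonempty ((S.equiv ^ (r : ℤ)).functor ≅ shiftFunctor C k))
    (hQ : ∃ Q : C, -ℓ + 1 ≤ (homDim K Q Q 1 : ℤ) ∧ (homDim K Q Q 1 : ℤ) < -2 * ℓ + 2)
    (h₁ : IsSerreInvariant S σ₁) (h₂ : IsSerreInvariant S σ₂) :
    ∃ γ : GL2PosCover, σ₁ = σ₂.act γ := by
  have hbound : ∀ {σ : NumStabilityCondition K C}, IsSerreInvariant S σ → SerreBound S σ := by
    rintro σ ⟨γ, h⟩ ψ E hE h0
    exact ⟨_, (GL2PosCover.map_lt hk' (h.iterate_eq hS hE h0)).le, h.P_obj hE⟩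
  obtain ⟨Q, hQ1, hQ2⟩ := hQ
  have key : ∀ {σ : NumStabilityCondition K C}, IsSerreInvariant S σ → ∃ p p',
      σ.P p Q ∧ σ.P p' (S.equiv.functor.obj Q) ∧ p < p' ∧ p' < p + 2 ∧
      cross (σ.Z (NumK0.of K Q)) (σ.Z (NumK0.of K (S.equiv.functor.obj Q))) ≠ 0 ∧
      (0 < cross (σ.Z (NumK0.of K Q)) (σ.Z (NumK0.of K (S.equiv.functor.obj Q))) ↔ k < r) := by
    intro σ hσ
    obtain ⟨h0, p, hp⟩ := (hbound hσ).exists_P hχ hQ1 hQ2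
    obtain ⟨γ, h⟩ := hσ
    have hit := h.iterate_eq hS hp h0
    have l1 := GL2PosCover.lt_map hk hit
    have l2 := GL2PosCover.map_lt hk' hit
    refine ⟨p, γ.g p, hp, h.P_obj hp, l1, l2, h.cross_ne_zero hχ hℓ hrank hp h0 l1 l2, ?_⟩
    obtain ⟨m, hm, e⟩ := σ.charge _ _ hp h0
    obtain ⟨m', hm', e'⟩ := σ.charge _ _ (h.P_obj hp) fun h' => h0 (S.isZero_iff.1 h')
    rw [cross_phaseVec_of_eq e e', mul_pos_iff_of_pos_left (mul_pos hm hm'),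
      GL2PosCover.sin_pos_iff (by linarith) (by linarith), sub_lt_iff_lt_add',
      GL2PosCover.map_lt_add_one_iff hr hk hk' hit]
  obtain ⟨h0, -⟩ := (hbound h₁).exists_P hχ hQ1 hQ2
  obtain ⟨p₁, p₁', a₁, b₁, c₁, d₁, e₁, f₁⟩ := key h₁
  obtain ⟨p₂, p₂', a₂, b₂, c₂, d₂, e₂, f₂⟩ := key h₂
  refine exists_eq_act hχ hℓ hrank (hbound h₁) (hbound h₂) h0
    (fun h => h0 (S.isZero_iff.1 h)) a₁ b₁ a₂ b₂ c₁ d₁ c₂ d₂ ?_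
  -- The two determinants are nonzero and have the same sign, dictated by `k < r`.
  by_cases hkr : k < r
  · exact mul_pos (f₁.2 hkr) (f₂.2 hkr)
  · exact mul_pos_of_neg_of_neg (lt_of_le_of_ne (not_lt.1 fun h => hkr (f₁.1 h)) e₁)
      (lt_of_le_of_ne (not_lt.1 fun h => hkr (f₂.1 h)) e₂)

end SerreInvariant

end StabCond

namespace StabCond

/-! ### Finiteness of classes of bounded charge -/

/-- A continuous positively homogeneous function that is positive on the nonzero points of a closed
cone is bounded below there by a multiple of the norm. -/
lemma exists_mul_norm_le {E F : Type*} [NormedAddCommGroup E] [NormedSpace ℝ E] [ProperSpace E]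
    [NormedAddCommGroup F] [NormedSpace ℝ F] (f : E →ₗ[ℝ] F) (hf : Continuous f)
    (q : QuadraticForm ℝ E) (hq : Continuous q) (h : ∀ x, x ≠ 0 → 0 ≤ q x → f x ≠ 0) :
    ∃ δ : ℝ, 0 < δ ∧ ∀ x, 0 ≤ q x → δ * ‖x‖ ≤ ‖f x‖ := by
  have hK : IsCompact (Metric.sphere (0 : E) 1 ∩ {x | 0 ≤ q x}) :=
    (isCompact_sphere 0 1).inter_right (isClosed_le continuous_const hq)
  obtain ⟨δ, hδ, hmin⟩ := hK.exists_forall_le' (f := fun x => ‖f x‖) hf.norm.continuousOn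
    (a := 0) fun x hx => norm_pos_iff.2 (h x (by rintro rfl; simp at hx) hx.2)
  refine ⟨δ, hδ, fun x hx => ?_⟩
  rcases eq_or_ne x 0 with rfl | h0
  · simp
  have hn : 0 < ‖x‖ := norm_pos_iff.2 h0
  have := hmin (‖x‖⁻¹ • x) ⟨by simp [norm_smul, hn.ne'], by
    simp only [Set.mem_ofPred_eq, QuadraticMap.map_smul, smul_eq_mul]
    positivity⟩
  simp only [map_smul, norm_smul, norm_inv, norm_norm] at this
  rwa [le_inv_mul_iff₀ hn, mul_comm] at this

section Lattice

variable {N : Type*} [AddCommGroup N] {B : N →+ N →+ ℤ} (hB : ∀ v, v ≠ 0 → B v v < 0)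
  (hN : Module.finrank ℤ N = 2)

include hB hN in
-- A degenerate Gram matrix makes `B(w, w) v - B(w, v) w` orthogonal to `v` and `w`, hence zero,
-- against independence.
lemma Indep.gram_ne_zero {v w : N} (h : Indep v w) : B v v * B w w - B v w * B w v ≠ 0 := by
  intro hD
  have h0 : B w w • v + (-B w v) • w = 0 := by
    refine h.eq_zero_of_orthogonal hB hN ?_ ?_
    · simp only [map_add, map_zsmul, smul_eq_mul]
      linarith
    · simp only [map_add, map_zsmul, smul_eq_mul]
      ring
  refine (hB w ?_).ne (h _ _ h0).1
  rintro rfl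
  have := h 0 1 (by simp)
  omega

include hB hN in
/-- The support property implies that there are only finitely many classes of bounded charge in
the cone on which the quadratic form is nonnegative. -/
lemma finite_classes (Z : N →+ ℂ) (q : QuadraticForm ℝ (ℝ ⊗[ℤ] N))
    (hq : ∀ x, Z.toIntLinearMap.liftBaseChange ℝ x = 0 → x ≠ 0 → q x < 0) (c : ℝ) :
    {v : N | 0 ≤ q (1 ⊗ₜ v) ∧ ‖Z v‖ ≤ c}.Finite := by
  obtain ⟨v, w, hvw⟩ := exists_indep hN
  have hD := hvw.gram_ne_zero hB hN
  let L : ℝ × ℝ →ₗ[ℝ] ℝ ⊗[ℤ] N :=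
    (LinearMap.fst ℝ ℝ ℝ).smulRight (1 ⊗ₜ v) + (LinearMap.snd ℝ ℝ ℝ).smulRight (1 ⊗ₜ w)
  have hL : ∀ a b : ℝ, L (a, b) = a ⊗ₜ v + b ⊗ₜ w := fun a b => by
    simp [L, TensorProduct.smul_tmul']
  let G : N → (ℝ ⊗[ℤ] N →ₗ[ℝ] ℝ) := fun x =>
    ((Int.castAddHom ℝ).comp (B x)).toIntLinearMap.liftBaseChange ℝ
  have hG : ∀ x a b, G x (L (a, b)) = a * B x v + b * B x w := fun x a b => by
    rw [hL]; simp [G]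
  have hLinj : ∀ x, L x = 0 → x = 0 := by
    rintro ⟨a, b⟩ hx
    have h1 := hG v a b
    have h2 := hG w a b
    rw [hx, map_zero] at h1 h2
    have hD' : (B v v * B w w - B v w * B w v : ℝ) ≠ 0 := by exact_mod_cast hD
    have ha : a * (B v v * B w w - B v w * B w v : ℝ) = 0 := by
      linear_combination (-(B w w : ℝ)) * h1 + (B v w : ℝ) * h2
    have hb : b * (B v v * B w w - B v w * B w v : ℝ) = 0 := by
      linear_combination (B w v : ℝ) * h1 - (B v v : ℝ) * h2
    rw [(mul_eq_zero.1 ha).resolve_right hD', (mul_eq_zero.1 hb).resolve_right hD']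
    rfl
  obtain ⟨δ, hδ, hle⟩ := exists_mul_norm_le ((Z.toIntLinearMap.liftBaseChange ℝ) ∘ₗ L)
    (LinearMap.continuous_of_finiteDimensional _) (q.comp L) (by
      have : ∀ x : ℝ × ℝ, q.comp L x = x.1 * x.1 * q (1 ⊗ₜ v) +
          x.2 * x.2 * q (1 ⊗ₜ w) + x.1 * x.2 * QuadraticMap.polar q (1 ⊗ₜ v) (1 ⊗ₜ w) := by
        rintro ⟨a, b⟩
        simp [L, QuadraticMap.map_add q, QuadraticMap.map_smul, QuadraticMap.polar_smul_left,
          QuadraticMap.polar_smul_right]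
        ring
      rw [show ⇑(q.comp L) = _ from funext this]
      fun_prop)
    (fun x hx h0 hZ => absurd h0 (not_le.2 (hq _ hZ fun h => hx (hLinj x h))))
  let R : ℝ := c / δ
  let S : N → ℤ := fun x => ⌈R * (|(B x v : ℝ)| + |(B x w : ℝ)|)⌉
  -- `N` is not known to be finitely generated, so the integral coordinates are the pairings with
  -- `v` and `w`. They separate points by definiteness and are bounded because the support property
  -- bounds the real coordinates.
  refine Set.Finite.of_finite_image (f := fun x => (B v x, B w x))
    (((Set.finite_Icc (-S v) (S v)).prod (Set.finite_Icc (-S w) (S w))).subset ?_) ?_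
  · rintro _ ⟨x, ⟨hx, hxc⟩, rfl⟩
    obtain ⟨n, a, b, hn, hrel⟩ := exists_relation hN hvw x
    have hn' : (n : ℝ) ≠ 0 := by exact_mod_cast hn
    have hxL : (1 : ℝ) ⊗ₜ[ℤ] x = L (a / n, b / n) := by
      have h1 : (n : ℝ) • ((1 : ℝ) ⊗ₜ[ℤ] x) = (n : ℝ) • L (a / n, b / n) := by
        have e1 : (n : ℝ) • ((1 : ℝ) ⊗ₜ[ℤ] x) = (1 : ℝ) ⊗ₜ[ℤ] (n • x) := by
          rw [Int.cast_smul_eq_zsmul, TensorProduct.tmul_smul]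
        rw [e1, hrel, ← map_smul, Prod.smul_mk, hL, TensorProduct.tmul_add,
          ← TensorProduct.smul_tmul, ← TensorProduct.smul_tmul, smul_eq_mul, smul_eq_mul,
          mul_div_cancel₀ _ hn', mul_div_cancel₀ _ hn']
        simp
      exact smul_right_injective _ hn' h1
    have hnorm : ‖((a / n : ℝ), (b / n : ℝ))‖ ≤ R := by
      have := hle (a / n, b / n) (by rw [QuadraticMap.comp_apply, ← hxL]; exact hx)
      rw [LinearMap.comp_apply, ← hxL, LinearMap.liftBaseChange_tmul, one_smul] at this
      rw [le_div_iff₀ hδ, mul_comm]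
      exact this.trans hxc
    have hcoord : ∀ y, B y x ∈ Set.Icc (-S y) (S y) := fun y => by
      have h1 : (B y x : ℝ) = (a / n) * B y v + (b / n) * B y w := by
        rw [← hG, ← hxL]; simp [G]
      have h2 : |(B y x : ℝ)| ≤ R * (|(B y v : ℝ)| + |(B y w : ℝ)|) := by
        rw [h1, mul_add]
        refine (abs_add_le _ _).trans (add_le_add ?_ ?_)
        · rw [abs_mul]
          exact mul_le_mul_of_nonneg_right ((norm_fst_le _).trans hnorm) (abs_nonneg _)
        · rw [abs_mul]
          exact mul_le_mul_of_nonneg_right ((norm_snd_le _).trans hnorm) (abs_nonneg _)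
      have h3 : |(B y x : ℝ)| ≤ S y := h2.trans (Int.le_ceil _)
      exact Set.mem_Icc.2 (abs_le.1 (by exact_mod_cast h3))
    exact ⟨hcoord v, hcoord w⟩
  · intro x _ y _ hxy
    simp only [Prod.mk.injEq] at hxy
    rw [← sub_eq_zero]
    exact hvw.eq_zero_of_orthogonal hB hN (by rw [map_sub, hxy.1, sub_self])
      (by rw [map_sub, hxy.2, sub_self])

end Lattice

end StabCond

namespace StabCond

/-! ### Simple objects among the semistable objects of a given phase -/

section Simple

variable {K : Type w} [Field K] {C : Type u} [Category.{v} C] [Preadditive C] [HasZeroObject C]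
  [HasShift C ℤ] [∀ n : ℤ, (shiftFunctor C n).Additive] [Pretriangulated C]
  [Linear K C] [∀ n : ℤ, (shiftFunctor C n).Linear K] [IsOfFiniteType K C]

namespace NumStabilityCondition

variable (σ : NumStabilityCondition K C)

/-- A nonzero semistable object all of whose nonzero maps to semistable objects of the same phase
are monomorphisms among these. These are the stable objects. -/
structure IsSimpleAt (φ : ℝ) (E : C) : Prop where
  mem : σ.P φ E
  not_isZero : ¬ IsZero E
  eq_zero_or : ∀ {D F : C} (g : D ⟶ E) (f : E ⟶ F), σ.P φ D → σ.P φ F → g ≫ f = 0 →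
    g = 0 ∨ f = 0

variable {σ} {φ φ' : ℝ} {E F : C}

lemma IsSimpleAt.map (h : σ.IsSimpleAt φ E) (Φ : C ⥤ C) [Φ.Full] [Φ.Faithful]
    [Φ.PreservesZeroMorphisms] (hE : σ.P φ' (Φ.obj E))
    (hΦ : ∀ D, σ.P φ' D → ∃ D', σ.P φ D' ∧ Nonempty (Φ.obj D' ≅ D)) :
    σ.IsSimpleAt φ' (Φ.obj E) := by
  refine ⟨hE, fun h0 => h.not_isZero (.of_full_of_faithful_of_isZero _ _ h0), ?_⟩
  intro D F g f hD hF hgf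
  obtain ⟨D', hD', ⟨d⟩⟩ := hΦ D hD
  obtain ⟨F', hF', ⟨e⟩⟩ := hΦ F hF
  obtain ⟨g', hg'⟩ := Φ.map_surjective (d.hom ≫ g)
  obtain ⟨f', hf'⟩ := Φ.map_surjective (f ≫ e.inv)
  have h0 : g' ≫ f' = 0 := by
    apply Φ.map_injective
    rw [Φ.map_comp, hg', hf', Category.assoc, reassoc_of% hgf, zero_comp, comp_zero, Φ.map_zero]
  rcases h.eq_zero_or g' f' hD' hF' h0 with rfl | rfl
  · left
    rw [Φ.map_zero] at hg'
    rw [← cancel_epi d.hom, ← hg', comp_zero]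
  · right
    rw [Φ.map_zero] at hf'
    rw [← cancel_mono e.inv, ← hf', zero_comp]

lemma IsSimpleAt.shift (h : σ.IsSimpleAt φ E) (n : ℤ) : σ.IsSimpleAt (φ + n) (E⟦n⟧) := by
  refine h.map (shiftFunctor C n) (σ.P_shift n h.mem) fun D hD => ⟨D⟦-n⟧, ?_, ?_⟩
  · have := σ.P_shift (-n) hD
    push_cast at this
    rwa [add_neg_cancel_right] at this
  · exact ⟨(shiftFunctorCompIsoId C (-n) n (by omega)).app D⟩

lemma cross_Z_pos {l : List (ℝ × C)} (h : HN σ.P l E) {a : ℂ}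
    (hl : ∀ x ∈ l, 0 < cross a (σ.Z (NumK0.of K x.2))) :
    0 ≤ cross a (σ.Z (NumK0.of K E)) ∧ (l ≠ [] → 0 < cross a (σ.Z (NumK0.of K E))) := by
  induction h with
  | zero h0 =>
    rw [NumK0.of_isZero K h0, map_zero]
    simp [cross]
  | cons T hT _ _ _ _ ih =>
    have h1 := (ih fun x hx => hl x (List.mem_cons_of_mem _ hx)).1
    have h2 := hl _ List.mem_cons_self
    rw [NumK0.of_triangle K T hT, map_add, cross_add_right]
    simp only at h2
    exact ⟨by linarith, fun _ => by linarith⟩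

lemma cross_Z_of_P {φ ψ : ℝ} (hE : σ.P ψ E) (h0 : ¬ IsZero E) :
    ∃ m : ℝ, 0 < m ∧
      cross (phaseVec φ) (σ.Z (NumK0.of K E)) = m * Real.sin (Real.pi * (ψ - φ)) := by
  obtain ⟨m, hm, e⟩ := σ.charge _ _ hE h0
  refine ⟨m, hm, ?_⟩
  rw [cross_phaseVec_of_eq (m := 1) (a := φ) (by simp) e, one_mul]

/-- The phases of the cone of a map between semistable objects of phase `φ` lie in
`[φ, φ + 1]`. -/
lemma HN_cone_mem {T : Triangle C} (hT : T ∈ distTriang C) (h₁ : σ.P φ T.obj₁)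
    (h₂ : σ.P φ T.obj₂) {l : List (ℝ × C)} (hl : HN σ.P l T.obj₃) :
    ∀ x ∈ l, φ ≤ x.1 ∧ x.1 ≤ φ + 1 := by
  have hrot := rot_of_distTriang _ hT
  have h₁' : σ.P (φ + (1 : ℤ)) (T.obj₁⟦(1 : ℤ)⟧) := σ.P_shift 1 h₁
  push_cast at h₁'
  intro x hx
  constructor
  · refine HN_le_of_noHom hl (fun ψ D hψ hD => ?_) x hx
    exact .ext_left hrot (noHom h₂ hD hψ) (noHom h₁' hD (by linarith))
  · refine HN_ge_of_noHom hl (fun ψ D hψ hD => ?_) x hx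
    exact .ext_right hrot (noHom hD h₂ (by linarith)) (noHom hD h₁' hψ)

/-- Schur's lemma. -/
lemma IsSimpleAt.nonempty_iso (hE : σ.IsSimpleAt φ E) (hF : σ.IsSimpleAt φ F)
    (h : ¬ NoHom E F) : Nonempty (E ≅ F) := by
  simp only [NoHom, not_forall] at h
  obtain ⟨f, hf⟩ := h
  obtain ⟨X, u, v, hT⟩ := distinguished_cocone_triangle f
  -- The phases of the cone lie in `[φ, φ + 1]`. Simplicity of `F` excludes `φ`, and simplicity of
  -- `E[1]` excludes `φ + 1`. A nonzero cone would then have charge strictly to one side of the line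
  -- of phase `φ`, but its charge is `Z(F) - Z(E)`, which lies on that line.
  suffices hX : IsZero X by
    have : IsIso f := (Triangle.isZero₃_iff_isIso₁ _ hT).1 hX
    exact ⟨asIso f⟩
  by_contra hX
  obtain ⟨l, hl⟩ := σ.exists_HN X
  have hl0 : l ≠ [] := by
    rintro rfl
    exact hX hl.isZero
  have hfu : f ≫ u = 0 := comp_distTriang_mor_zero₁₂ _ hT
  have hmem := HN_cone_mem hT hE.mem hF.mem hl
  have hE1 : σ.P (φ + (1 : ℤ)) (E⟦(1 : ℤ)⟧) := σ.P_shift 1 hE.mem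
  have hlow : ∀ x ∈ l, φ < x.1 := by
    cases hl with
    | zero => simp
    | @cons l ψ T' hT' h1 h2 h3 h4 =>
      have hψ : φ < ψ := by
        refine lt_of_le_of_ne (hmem _ List.mem_cons_self).1 ?_
        rintro rfl
        rcases hF.eq_zero_or f (u ≫ T'.mor₂) hE.mem h3 (by rw [reassoc_of% hfu, zero_comp])
          with h0 | h0
        · exact hf h0
        · obtain ⟨k, hk⟩ : ∃ k : E⟦(1 : ℤ)⟧ ⟶ T'.obj₃, T'.mor₂ = v ≫ k :=
            Triangle.yoneda_exact₃ _ hT T'.mor₂ h0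
          refine HN_mor₂_ne_zero hT' h1 h2 h3 h4 ?_
          rw [hk, noHom hE1 h3 (by push_cast; linarith) k, comp_zero]
      intro x hx
      rcases List.mem_cons.1 hx with rfl | hx
      · exact hψ
      · exact hψ.trans (h4 x hx)
  have hhigh : ∀ x ∈ l, x.1 < φ + 1 := by
    obtain ⟨x, hx, hmax, hx'⟩ := HN_exists_max hl hl0
    have hxP := (hl.mem x hx).1
    intro y hy
    refine (hmax y hy).trans_lt (lt_of_le_of_ne (hmem x hx).2 fun hxφ => hx' fun a => ?_)
    rw [hxφ] at hxP
    have hs := hE.shift 1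
    push_cast at hs
    have hF1 := σ.P_shift 1 hF.mem
    push_cast at hF1
    have hvf : v ≫ f⟦(1 : ℤ)⟧' = 0 := comp_distTriang_mor_zero₃₁ _ hT
    rcases hs.eq_zero_or (a ≫ v) (f⟦(1 : ℤ)⟧') hxP hF1
      (by rw [Category.assoc, hvf, comp_zero]) with h0 | h0
    · obtain ⟨k, rfl⟩ : ∃ k : x.2 ⟶ F, a = k ≫ u := Triangle.coyoneda_exact₃ _ hT a h0
      rw [noHom hxP hF.mem (by linarith) k, zero_comp]
    · exact absurd ((shiftFunctor C (1 : ℤ)).map_injective (h0.trans (Functor.map_zero _ _ _).symm))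
        hf
  have hpos := (cross_Z_pos hl (a := phaseVec φ) fun x hx => by
    obtain ⟨m, hm, e⟩ := cross_Z_of_P (φ := φ) (hl.mem x hx).1 (hl.mem x hx).2
    rw [e]
    have := hlow x hx
    have := hhigh x hx
    exact mul_pos hm (Real.sin_pos_of_pos_of_lt_pi (mul_pos Real.pi_pos (by linarith))
      (by nlinarith [Real.pi_pos]))).2 hl0
  obtain ⟨m, -, e⟩ := cross_Z_of_P (φ := φ) hE.mem hE.not_isZero
  obtain ⟨m', -, e'⟩ := cross_Z_of_P (φ := φ) hF.mem hF.not_isZero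
  have hsum : NumK0.of K F = NumK0.of K E + NumK0.of K X := NumK0.of_triangle K _ hT
  rw [hsum, map_add, cross_add_right, e, sub_self, mul_zero, Real.sin_zero, mul_zero, mul_zero,
    zero_add] at e'
  exact hpos.ne' e'

/-- A semistable object that is not simple is a nontrivial extension of semistable objects of the
same phase. -/
lemma isSimpleAt_or_exists_triangle (hE : σ.P φ E) (h0 : ¬ IsZero E) : σ.IsSimpleAt φ E ∨
    ∃ (A B : C) (i : A ⟶ E) (p : E ⟶ B) (j : B ⟶ A⟦(1 : ℤ)⟧), Triangle.mk i p j ∈ distTriang C ∧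
      σ.P φ A ∧ σ.P φ B ∧ ¬ IsZero A ∧ ¬ IsZero B := by
  by_contra! hcon
  obtain ⟨hns, hcon⟩ := hcon
  refine hns ⟨hE, h0, ?_⟩
  intro D F g f hD hF hgf
  by_contra! hne
  obtain ⟨hg, hf⟩ := hne
  obtain ⟨X, u, v, hT⟩ := distinguished_cocone_triangle g
  obtain ⟨f', rfl⟩ : ∃ f' : X ⟶ F, f = u ≫ f' := Triangle.yoneda_exact₂ _ hT f hgf
  have hgu : g ≫ u = 0 := comp_distTriang_mor_zero₁₂ _ hT
  obtain ⟨l, hl⟩ := σ.exists_HN X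
  have hmem := HN_cone_mem hT hD hE hl
  have hXF : ¬ NoHom X F := fun h => hf (by rw [h f', comp_zero])
  cases hl with
  | zero hz => exact hXF (.of_isZero_left hz)
  | @cons l ψ T' hT' h1 h2 h3 h4 =>
    -- Were the least phase of the cone above `φ`, no map from it to `F` could be nonzero, yet `f`
    -- factors through one.
    have hψ : ψ = φ := by
      refine le_antisymm ?_ (hmem _ List.mem_cons_self).1
      by_contra! hψ
      refine hXF ((HN.cons T' hT' h1 h2 h3 h4).noHom_left fun x hx => ?_)
      rcases List.mem_cons.1 hx with rfl | hx
      · exact noHom h3 hF hψ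
      · exact noHom (h1.mem x hx).1 hF (hψ.trans (h4 x hx))
    subst hψ
    -- The least-phase factor of the cone of `g` serves as a quotient of `E`, and `A` is its kernel.
    -- Maps from `A` to smaller phases are traced through the triangles to maps from `D`, `T'.obj₁`
    -- and `E`, all zero.
    obtain ⟨A, i, j, hA⟩ := distinguished_cocone_triangle₁ (u ≫ T'.mor₂)
    refine h2 (hcon A T'.obj₃ i (u ≫ T'.mor₂) j hA (P_of_noHom ?_ ?_) h3 fun hA0 => hg ?_)
    · intro χ H hχ hH t
      have hw : (u ≫ T'.mor₂) ≫ j = 0 := comp_distTriang_mor_zero₂₃ _ hA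
      have hz : T'.mor₂ ≫ j ≫ t⟦(1 : ℤ)⟧' = 0 := by
        rw [Category.assoc] at hw
        obtain ⟨k, hk⟩ : ∃ k : D⟦(1 : ℤ)⟧ ⟶ H⟦(1 : ℤ)⟧, T'.mor₂ ≫ j ≫ t⟦(1 : ℤ)⟧' = v ≫ k :=
          Triangle.yoneda_exact₃ _ hT (T'.mor₂ ≫ j ≫ t⟦(1 : ℤ)⟧')
            (show u ≫ T'.mor₂ ≫ j ≫ t⟦(1 : ℤ)⟧' = 0 by rw [reassoc_of% hw, zero_comp])
        rw [hk, (noHom hD hH hχ).shift 1 k, comp_zero]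
      have hz' : j ≫ t⟦(1 : ℤ)⟧' = 0 := by
        obtain ⟨k, hk⟩ := T'.yoneda_exact₃ hT' _ hz
        have : NoHom (T'.obj₁⟦(1 : ℤ)⟧) (H⟦(1 : ℤ)⟧) :=
          (h1.noHom_left fun x hx => noHom (h1.mem x hx).1 hH (hχ.trans (h4 x hx))).shift 1
        rw [hk, this k, comp_zero]
      obtain ⟨k, hk⟩ : ∃ k : E⟦(1 : ℤ)⟧ ⟶ H⟦(1 : ℤ)⟧, t⟦(1 : ℤ)⟧' = (-i⟦(1 : ℤ)⟧') ≫ k :=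
        Triangle.yoneda_exact₃ _ (rot_of_distTriang _ hA) (t⟦(1 : ℤ)⟧') hz'
      apply (shiftFunctor C (1 : ℤ)).map_injective
      rw [Functor.map_zero, hk, (noHom hE hH hχ).shift 1 k, comp_zero]
    · intro χ H hχ hH
      exact NoHom.ext_right (inv_rot_of_distTriang _ hA)
        (noHom_shift hH h3 (n := -1) (by push_cast; linarith)) (noHom hH hE hχ)
    · have : IsIso (u ≫ T'.mor₂) := (Triangle.isZero₁_iff_isIso₂ _ hA).1 hA0
      rw [← cancel_mono (u ≫ T'.mor₂), reassoc_of% hgu, zero_comp, zero_comp]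

/-- Induction over semistable objects of a given phase. -/
lemma P_induction (hχ : ∀ v : NumK0 K C, v ≠ 0 → numEulerForm K C v v < 0)
    (hrank : Module.finrank ℤ (NumK0 K C) = 2) {p : C → Prop}
    (hs : ∀ E, σ.IsSimpleAt φ E → p E)
    (hext : ∀ T ∈ distTriang C, σ.P φ T.obj₁ → σ.P φ T.obj₃ → p T.obj₁ → p T.obj₃ → p T.obj₂)
    (hE : σ.P φ E) (h0 : ¬ IsZero E) : p E := by
  let mass : C → ℝ := fun E => ‖σ.Z (NumK0.of K E)‖
  let s : Set ℝ := {x | ∃ A : C, σ.P φ A ∧ ¬ IsZero A ∧ mass A = x}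
  -- The support property makes the set of possible masses locally finite, so the number of smaller
  -- masses serves as induction parameter.
  have hfin : ∀ c, (s ∩ Set.Iio c).Finite := fun c => by
    obtain ⟨q, hq, hq'⟩ := σ.support
    refine ((finite_classes hχ hrank σ.Z q hq c).image fun x => ‖σ.Z x‖).subset ?_
    rintro _ ⟨⟨A, hA, -, rfl⟩, hc⟩
    exact ⟨NumK0.of K A, ⟨hq' φ A hA, hc.le⟩, rfl⟩
  have hlt : ∀ {A B : C}, σ.P φ A → ¬ IsZero A → mass A < mass B →
      (s ∩ Set.Iio (mass A)).ncard < (s ∩ Set.Iio (mass B)).ncard := fun {A B} hA h0 h =>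
    Set.ncard_lt_ncard ⟨fun x hx => ⟨hx.1, lt_trans hx.2 h⟩,
      fun h' => lt_irrefl (mass A) (h' ⟨⟨A, hA, h0, rfl⟩, h⟩).2⟩ (hfin _)
  induction hn : (s ∩ Set.Iio (mass E)).ncard using Nat.strong_induction_on generalizing E with
  | _ n ih =>
    subst hn
    rcases isSimpleAt_or_exists_triangle hE h0 with h | ⟨A, B, i, q, j, hT, hA, hB, hA0, hB0⟩
    · exact hs E h
    obtain ⟨m, hm, e⟩ := σ.charge _ _ hA hA0
    obtain ⟨m', hm', e'⟩ := σ.charge _ _ hB hB0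
    have hsum : NumK0.of K E = NumK0.of K A + NumK0.of K B := NumK0.of_triangle K _ hT
    have hmA : mass A = m := by
      simp only [mass, e]
      simp [norm_phaseVec, abs_of_pos hm]
    have hmB : mass B = m' := by
      simp only [mass, e']
      simp [norm_phaseVec, abs_of_pos hm']
    have hmE : mass E = m + m' := by
      simp only [mass, hsum, map_add, e, e']
      rw [← add_mul, norm_mul, norm_phaseVec, mul_one, ← Complex.ofReal_add, Complex.norm_real,
        Real.norm_of_nonneg (by positivity)]
    exact hext _ hT hA hB (ih _ (hlt hA hA0 (by rw [hmA, hmE]; linarith)) hA hA0 rfl)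
      (ih _ (hlt hB hB0 (by rw [hmB, hmE]; linarith)) hB hB0 rfl)

end NumStabilityCondition

end Simple

/-! ### Serre functors whose square is the shift by four -/

section CalabiYau

variable {K : Type w} [Field K] {C : Type u} [Category.{v} C] [Preadditive C] [HasZeroObject C]
  [HasShift C ℤ] [∀ n : ℤ, (shiftFunctor C n).Additive] [Pretriangulated C]
  [Linear K C] [∀ n : ℤ, (shiftFunctor C n).Linear K] [IsOfFiniteType K C]

open NumStabilityCondition

variable {S : SerreFunctor K C} {σ σ₁ σ₂ : NumStabilityCondition K C}
  {ℓ : ℤ} (hχ : ∀ v : NumK0 K C, v ≠ 0 → numEulerForm K C v v ≤ ℓ) (hℓ : ℓ < 0)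
  (hrank : Module.finrank ℤ (NumK0 K C) = 2)
  (hS : Nonempty ((S.equiv ^ ((2 : ℕ) : ℤ)).functor ≅ shiftFunctor C (4 : ℤ)))

include hS in
lemma IsSerreInvariant.exists_add_two (hσ : IsSerreInvariant S σ) :
    ∃ γ : GL2PosCover, IsImage S.equiv σ (σ.act γ) ∧
      ∀ ψ E, σ.P ψ E → ¬ IsZero E → γ.g ψ = ψ + 2 := by
  obtain ⟨γ, h⟩ := hσ
  refine ⟨γ, h, fun ψ E hE h0 => GL2PosCover.map_eq_add_two ?_⟩
  exact_mod_cast h.iterate_eq hS hE h0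

include hS in
lemma IsSerreInvariant.serreBound (hσ : IsSerreInvariant S σ) : SerreBound S σ := by
  obtain ⟨γ, h, hγ⟩ := hσ.exists_add_two hS
  exact fun ψ E hE h0 => ⟨_, (hγ ψ E hE h0).le, h.P_obj hE⟩

include hS in
lemma IsSerreInvariant.isSimpleAt_serre (hσ : IsSerreInvariant S σ) {φ : ℝ} {E : C}
    (hE : σ.IsSimpleAt φ E) : σ.IsSimpleAt (φ + 2) (S.equiv.functor.obj E) := by
  obtain ⟨γ, h, hγ⟩ := hσ.exists_add_two hS
  have := S.additive
  rw [← hγ φ E hE.mem hE.not_isZero]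
  exact hE.map S.equiv.functor (h.P_obj hE.mem) fun D hD => h.exists_preimage hD

include hχ hℓ hS

/-- `S²` is trivial on classes, since the shift by 4 is. The difference `d = [S E] - [E]` then
satisfies `χ(d, d) = 0`, so `d = 0` by definiteness. -/
lemma NumK0.of_serre_eq (E : C) : NumK0.of K (S.equiv.functor.obj E) = NumK0.of K E := by
  obtain ⟨e⟩ := hS
  have hSS : NumK0.of K (S.equiv.functor.obj (S.equiv.functor.obj E)) = NumK0.of K E := by
    have h4 : (4 : ℤ).negOnePow = 1 := by decide
    have h1 : NumK0.of K (S.equiv.functor.obj (S.equiv.functor.obj E)) = NumK0.of K (E⟦(4 : ℤ)⟧) :=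
      NumK0.of_iso K (e.app E)
    rw [h1, NumK0.of_shift, h4]
    simp
  have hsw : eulerObj K (S.equiv.functor.obj E) E = eulerObj K E E := by
    rw [← S.eulerObj_eq, ← numEulerForm_of, hSS, numEulerForm_of]
  rw [← sub_eq_zero]
  by_contra hd
  refine ((hχ _ hd).trans_lt hℓ).ne ?_
  simp only [map_sub, AddMonoidHom.sub_apply, numEulerForm_of, S.eulerObj_eq, hsw]
  ring

lemma eulerObj_comm (E F : C) : eulerObj K E F = eulerObj K F E := by
  rw [← S.eulerObj_eq, ← numEulerForm_of, NumK0.of_serre_eq hχ hℓ hS, numEulerForm_of]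

/-- A nonzero `hom⁰` makes `A ≅ B` by Schur. A nonzero `hom²` is dual to a nonzero map `B[2] ⟶ S A`
of simple objects of phase `φ + 2`, so `[A] = [B]`. In both cases `χ(A, B) = χ(A, A) < 0`; otherwise
only `hom¹` is left. -/
lemma IsSerreInvariant.eulerObj_simple (hσ : IsSerreInvariant S σ) {φ : ℝ} {A B : C}
    (hA : σ.IsSimpleAt φ A) (hB : σ.IsSimpleAt φ B) :
    eulerObj K A B < 0 ∨ eulerObj K A B = -(homDim K A B 1 : ℤ) := by
  have hself : eulerObj K A A < 0 := by
    rw [← numEulerForm_of]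
    exact (hχ _ (of_ne_zero hA.mem hA.not_isZero)).trans_lt hℓ
  by_cases h0 : NoHom A B
  · by_cases h2 : NoHom A (B⟦(2 : ℤ)⟧)
    · right
      rw [(hσ.serreBound hS).eulerObj_eq hA.mem hB.mem, homDim_eq_zero K h2,
        homDim_eq_zero K (h0.of_iso (Iso.refl A) ((shiftFunctorZero C ℤ).app B))]
      simp
    · left
      have hB2 := hB.shift 2
      push_cast at hB2
      obtain ⟨e⟩ := hB2.nonempty_iso (hσ.isSimpleAt_serre hS hA) fun h => h2 (S.noHom_of h)
      have h2' : (2 : ℤ).negOnePow = 1 := by decide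
      have hcl := NumK0.of_iso K e
      rw [NumK0.of_serre_eq hχ hℓ hS, NumK0.of_shift, h2', Units.val_one, one_zsmul] at hcl
      rwa [← numEulerForm_of, hcl, numEulerForm_of]
  · left
    obtain ⟨e⟩ := hA.nonempty_iso hB h0
    rwa [← numEulerForm_of, ← NumK0.of_iso K e, numEulerForm_of]

include hrank

/-- Both claims propagate from simple objects through extensions in each variable: a nonzero `Hom(B,
A[1])` persists on some piece, and the other pieces contribute at most zero. -/
lemma IsSerreInvariant.eulerObj_nonpos (hσ : IsSerreInvariant S σ) {φ : ℝ} {A B : C}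
    (hA : σ.P φ A) (hA0 : ¬ IsZero A) (hB : σ.P φ B) (hB0 : ¬ IsZero B) :
    eulerObj K A B ≤ 0 ∧ (¬ NoHom B (A⟦(1 : ℤ)⟧) → eulerObj K A B < 0) := by
  have hneg : ∀ v : NumK0 K C, v ≠ 0 → numEulerForm K C v v < 0 := fun v hv =>
    (hχ v hv).trans_lt hℓ
  refine P_induction hneg hrank (p := fun A => eulerObj K A B ≤ 0 ∧
    (¬ NoHom B (A⟦(1 : ℤ)⟧) → eulerObj K A B < 0)) (fun A hA => ?_) ?_ hA hA0
  · refine P_induction hneg hrank (p := fun B => eulerObj K A B ≤ 0 ∧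
      (¬ NoHom B (A⟦(1 : ℤ)⟧) → eulerObj K A B < 0)) (fun B hB => ?_) ?_ hB hB0
    -- The extension group runs from `B` to `A`, so strictness uses the dichotomy for `(B, A)` and
    -- the symmetry of `χ`.
    · have h1 := hσ.eulerObj_simple hχ hℓ hS hA hB
      have h2 := hσ.eulerObj_simple hχ hℓ hS hB hA
      rw [eulerObj_comm hχ hℓ hS B A] at h2
      refine ⟨by omega, fun h => ?_⟩
      have := homDim_pos K h
      omega
    · intro T hT _ _ ih₁ ih₃
      rw [eulerObj_add_right A T hT]
      refine ⟨by omega, fun h => ?_⟩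
      by_cases h₁ : NoHom T.obj₁ (A⟦(1 : ℤ)⟧)
      · have := ih₃.2 fun h₃ => h (h₁.ext_left hT h₃)
        omega
      · have := ih₁.2 h₁
        omega
  · intro T hT _ _ ih₁ ih₃
    rw [eulerObj_add_left B T hT]
    refine ⟨by omega, fun h => ?_⟩
    by_cases h₁ : NoHom B (T.obj₁⟦(1 : ℤ)⟧)
    · have := ih₃.2 fun h₃ => h (by
        rw [noHom_shift_right_iff (n := -1) (by norm_num)] at h₁ h₃ ⊢
        exact h₁.ext_right hT h₃)
      omega
    · have := ih₁.2 h₁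
      omega

/-- If `Q` were an extension of `B` by `A`, then `χ(Q, Q) = χ(A, A) + 2χ(A, B) + χ(B, B) ≤ 2ℓ`. A
split extension has `hom⁰ ≥ 2`, and a nonsplit one has `χ(A, B) ≤ -1`. Either way `hom¹(Q, Q) ≥ 2 -
2ℓ`. -/
lemma IsSerreInvariant.isSimpleAt (hσ : IsSerreInvariant S σ) {φ : ℝ} {Q : C} (hQ : σ.P φ Q)
    (h0 : ¬ IsZero Q) (h1 : (homDim K Q Q 1 : ℤ) < -2 * ℓ + 2) : σ.IsSimpleAt φ Q := by
  refine (isSimpleAt_or_exists_triangle hQ h0).resolve_right ?_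
  rintro ⟨A, B, i, p, j, hT, hA, hB, hA0, hB0⟩
  have hAA := hχ _ (of_ne_zero hA hA0)
  have hBB := hχ _ (of_ne_zero hB hB0)
  rw [numEulerForm_of] at hAA hBB
  obtain ⟨hAB, hAB'⟩ := hσ.eulerObj_nonpos hχ hℓ hrank hS hA hA0 hB hB0
  have hcomm := eulerObj_comm hχ hℓ hS A B
  have hsum : eulerObj K Q Q =
      eulerObj K A A + eulerObj K A B + (eulerObj K B A + eulerObj K B B) := by
    have e₁ : ∀ X : C, eulerObj K X Q = eulerObj K X A + eulerObj K X B := fun X =>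
      eulerObj_add_right X _ hT
    have e₂ : eulerObj K Q Q = eulerObj K A Q + eulerObj K B Q := eulerObj_add_left Q _ hT
    rw [e₂, e₁, e₁]
  have hQQ := (hσ.serreBound hS).eulerObj_eq hQ hQ
  have hone := one_le_homDim_zero K h0
  by_cases hj : j = 0
  · suffices h2 : 2 ≤ homDim K Q Q 0 by omega
    by_contra! h2
    have h2' : Module.finrank K (Q ⟶ Q) = 1 := by
      rw [← homDim_zero_eq]
      omega
    subst hj
    obtain ⟨s, hs⟩ : ∃ s : B ⟶ Q, 𝟙 B = s ≫ p :=
      Triangle.coyoneda_exact₃ _ hT (𝟙 B) comp_zero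
    have hip : i ≫ p = 0 := comp_distTriang_mor_zero₁₂ _ hT
    -- If all endomorphisms were scalars, the splitting idempotent `p ≫ s` would be one. It kills `i
    -- ≠ 0`, so it vanishes, and then `B = 0`.
    obtain ⟨c, hc⟩ := (finrank_eq_one_iff_of_nonzero' (𝟙 Q)
      fun h => h0 ((IsZero.iff_id_eq_zero Q).2 h)).1 h2' (p ≫ s)
    have hi : i ≠ 0 := fun hi => hA0 ((Triangle.isZero₁_iff _ hT).2 ⟨hi, rfl⟩)
    have hci : c • i = 0 := by
      rw [← Category.comp_id i, ← Linear.comp_smul, hc, reassoc_of% hip, zero_comp]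
    have hc0 : c = 0 := (smul_eq_zero.1 hci).resolve_right hi
    rw [hc0, zero_smul] at hc
    refine hB0 ((IsZero.iff_id_eq_zero B).2 ?_)
    have : s ≫ (p ≫ s) ≫ p = 𝟙 B := by
      rw [Category.assoc, ← hs, Category.comp_id, ← hs]
    rw [← this, ← hc, zero_comp, comp_zero]
  · have := hAB' fun h => hj (h j)
    omega

/-- The case of a Serre functor whose square is the shift by four. -/
lemma exists_eq_act_of_dim_two (hQ : ∃ Q₁ Q₂ : C,
      (-ℓ + 1 ≤ (homDim K Q₁ Q₁ 1 : ℤ) ∧ (homDim K Q₁ Q₁ 1 : ℤ) < -2 * ℓ + 2) ∧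
      (-ℓ + 1 ≤ (homDim K Q₂ Q₂ 1 : ℤ) ∧ (homDim K Q₂ Q₂ 1 : ℤ) < -2 * ℓ + 2) ∧
      IsEmpty (Q₁ ≅ Q₂) ∧ IsEmpty (Q₁ ≅ Q₂⟦(1 : ℤ)⟧) ∧
      (∃ f : Q₂ ⟶ Q₁, f ≠ 0) ∧ (∃ f : Q₁ ⟶ Q₂⟦(1 : ℤ)⟧, f ≠ 0))
    (h₁ : IsSerreInvariant S σ₁) (h₂ : IsSerreInvariant S σ₂) :
    ∃ γ : GL2PosCover, σ₁ = σ₂.act γ := by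
  obtain ⟨Q₁, Q₂, ⟨a₁, b₁⟩, ⟨a₂, b₂⟩, hiso, hiso', ⟨f, hf⟩, ⟨f', hf'⟩⟩ := hQ
  have key : ∀ {σ : NumStabilityCondition K C}, IsSerreInvariant S σ → ∃ p p',
      σ.P p Q₂ ∧ σ.P p' Q₁ ∧ p < p' ∧ p' < p + 2 ∧
      0 < cross (σ.Z (NumK0.of K Q₂)) (σ.Z (NumK0.of K Q₁)) := by
    intro σ hσ
    obtain ⟨z₁, p₁, hp₁⟩ := (hσ.serreBound hS).exists_P hχ a₁ b₁
    obtain ⟨z₂, p₂, hp₂⟩ := (hσ.serreBound hS).exists_P hχ a₂ b₂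
    have s₁ := hσ.isSimpleAt hχ hℓ hrank hS hp₁ z₁ b₁
    have s₂ := hσ.isSimpleAt hχ hℓ hrank hS hp₂ z₂ b₂
    have n : ¬ NoHom Q₂ Q₁ := fun h => hf (h f)
    have n' : ¬ NoHom Q₁ (Q₂⟦(1 : ℤ)⟧) := fun h => hf' (h f')
    -- The nonzero maps give weak inequalities; equality would make two stable objects isomorphic,
    -- which is excluded.
    have l₁ : p₂ < p₁ := by
      refine lt_of_le_of_ne (le_of_not_noHom hp₂ hp₁ n) ?_
      rintro rfl
      obtain ⟨e⟩ := s₂.nonempty_iso s₁ n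
      exact hiso.elim e.symm
    have l₂ : p₁ < p₂ + 1 := by
      have s := s₂.shift 1
      push_cast at s
      refine lt_of_le_of_ne (le_of_not_noHom hp₁ s.mem n') ?_
      rintro rfl
      obtain ⟨e⟩ := s₁.nonempty_iso s n'
      exact hiso'.elim e
    refine ⟨p₂, p₁, hp₂, hp₁, l₁, by linarith, ?_⟩
    obtain ⟨m, hm, e⟩ := σ.charge _ _ hp₂ z₂
    obtain ⟨m', hm', e'⟩ := σ.charge _ _ hp₁ z₁
    rw [cross_phaseVec_of_eq e e']
    exact mul_pos (mul_pos hm hm') (Real.sin_pos_of_pos_of_lt_pi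
      (mul_pos Real.pi_pos (by linarith)) (by nlinarith [Real.pi_pos]))
  obtain ⟨z₁, -⟩ := (h₁.serreBound hS).exists_P hχ a₁ b₁
  obtain ⟨z₂, -⟩ := (h₁.serreBound hS).exists_P hχ a₂ b₂
  obtain ⟨p, p', hp, hp', l, l', hc⟩ := key h₁
  obtain ⟨q, q', hq, hq', m, m', hd⟩ := key h₂
  exact exists_eq_act hχ hℓ hrank (h₁.serreBound hS) (h₂.serreBound hS) z₂ z₁
    hp hp' hq hq' l l' m m' (mul_pos hc hd)

end CalabiYau

end StabCond

theorem theorem3p2 {K : Type*} [Field K] {C : Type*} [Category C] [Preadditive C]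
    [HasZeroObject C] [HasShift C ℤ] [∀ n : ℤ, (shiftFunctor C n).Additive]
    [Pretriangulated C] [IsTriangulated C] [Linear K C]
    [∀ n : ℤ, (shiftFunctor C n).Linear K] [StabCond.IsOfFiniteType K C]
    (S : StabCond.SerreFunctor K C)
    -- (C1)
    (r : ℕ) (k : ℤ) (hr : 0 < r)
    (hS : Nonempty ((S.equiv ^ (r : ℤ)).functor ≅ shiftFunctor C k))
    (hrk : (0 < (k : ℚ) / r ∧ (k : ℚ) / r < 2) ∨ (r = 2 ∧ k = 4))
    -- (C2)
    (hrank : Module.finrank ℤ (StabCond.NumK0 K C) = 2)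
    (ℓ : ℤ)
    (hmax : IsGreatest {m : ℤ | ∃ v : StabCond.NumK0 K C, v ≠ 0 ∧
      m = StabCond.numEulerForm K C v v} ℓ)
    (hneg : ℓ < 0)
    -- (C3)
    (hQ : ∃ Q : C, -ℓ + 1 ≤ (StabCond.homDim K Q Q 1 : ℤ) ∧
      (StabCond.homDim K Q Q 1 : ℤ) < -2 * ℓ + 2)
    (hQQ : r = 2 ∧ k = 4 → ∃ Q₁ Q₂ : C,
      (-ℓ + 1 ≤ (StabCond.homDim K Q₁ Q₁ 1 : ℤ) ∧
        (StabCond.homDim K Q₁ Q₁ 1 : ℤ) < -2 * ℓ + 2) ∧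
      (-ℓ + 1 ≤ (StabCond.homDim K Q₂ Q₂ 1 : ℤ) ∧
        (StabCond.homDim K Q₂ Q₂ 1 : ℤ) < -2 * ℓ + 2) ∧
      IsEmpty (Q₁ ≅ Q₂) ∧ IsEmpty (Q₁ ≅ Q₂⟦(1 : ℤ)⟧) ∧
      (∃ f : Q₂ ⟶ Q₁, f ≠ 0) ∧ (∃ f : Q₁ ⟶ Q₂⟦(1 : ℤ)⟧, f ≠ 0))
    (σ₁ σ₂ : StabCond.NumStabilityCondition K C)
    (h₁ : StabCond.IsSerreInvariant S σ₁) (h₂ : StabCond.IsSerreInvariant S σ₂) :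
    ∃ γ : StabCond.GL2PosCover, σ₁ = σ₂.act γ := by

  have hχ : ∀ v : StabCond.NumK0 K C, v ≠ 0 → StabCond.numEulerForm K C v v ≤ ℓ := fun v hv =>
    hmax.2 ⟨v, hv, rfl⟩
  rcases hrk with ⟨hk, hk'⟩ | hrk
  · have hr' : (0 : ℚ) < r := by exact_mod_cast hr
    have hk0 : (0 : ℚ) < k := by
      rw [lt_div_iff₀ hr', zero_mul] at hk
      exact hk
    rw [div_lt_iff₀ hr'] at hk'
    exact StabCond.exists_eq_act_of_dim_lt_two hχ hneg hrank hr (by exact_mod_cast hk0)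
      (by exact_mod_cast hk') hS hQ h₁ h₂
  · obtain ⟨rfl, rfl⟩ := id hrk
    exact StabCond.exists_eq_act_of_dim_two hχ hneg hrank hS (hQQ hrk) h₁ h₂
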